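/- Consider $N$ arms with covariates $a_1,\dots,a_N$, i.i.d. uniform on $[0,1]$. Conditionally on the covariates, the rewards $y_1,\dots,y_N\in[0,1]$ are independent and $y_i$ has mean $m(a_i)$, where $m:[0,1]\to[0,1]$. An agent with budget $T$ pulls distinct arms $\phi(1),\dots,\phi(T)$ one after the other, observing the reward of each arm pulled. Let $p=T/N\in(0,1)$, and let the regret be $$R_T=\sum_{t\le T}m(a_{\phi^*(t)})-\sum_{t\le T}m(a_{\phi(t)}),$$ where $\phi^*$ is a permutation of $\{1,\dots,N\}$ with $m(a_{\phi^*(1)})\ge\dots\ge m(a_{\phi^*(N)})$. Let $\lambda$ be Lebesgue measure on $[0,1]$ and $M=\inf\{A:\lambda(\{x:m(x)\ge A\})<p\}$. UCBF with parameters $K,\delta$ is the following strategy. Split $[0,1]$ into $I_k=[\frac{k-1}K,\frac kK)$ for $1\le k<K$ and $I_K=[\frac{K-1}K,1]$. An interval is alive if it contained at least two arms at the start and still contains an arm that has not been pulled. First one arm is pulled in each alive interval; then, until $T$ arms have been pulled, an alive interval $I_k$ is selected that maximizes $\widehat m_k+\sqrt{\log(T/\delta)/(2n_k)}$ (ties broken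 arbitrarily), where $n_k$ is the number of arms pulled so far in $I_k$ and $\widehat m_k$ is the average of their rewards, and an arm of it is pulled. Each arm pulled is drawn uniformly at random among the arms of its interval not yet pulled. (If no interval is alive before $T$ arms have been pulled, the remaining pulls are arbitrary.) **Theorem.** For all $L,Q>0$ there is a constant $C_{L,Q}$, depending only on $L$ and $Q$, such that the following holds. Assume that $|m(x)-m(y)|\le\max\{|M-m(x)|,\,L|x-y|\}$ for all $x,y\in[0,1]$, that $\lambda(\{x:|M-m(x)|\le\epsilon\})\le Q\epsilon$ for all $\epsilon\in(0,1)$, and that $\lfloor N^{1/3}\log(N)^{-2/3}\rfloor>p^{-1}\vee(1-p)^{-1}$. Then UCBF with $K=\lfloor N^{1/3}\log(N)^{-2/3}\rfloor$ and $\delta=N^{-4/3}$ satisfies $$R_T\le C_{L,Q}\,(T/p)^{1/3}\log(T/p)^{4/3}$$ with probability at least $1-12\left(N^{-1}\vee e^{-N^{1/3}/3}\right)$. -/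

import Mathlib

open MeasureTheory ProbabilityTheory

noncomputable section

namespace FCAB

/-! ### Mean reward function: threshold, weak Lipschitz condition, margin condition -/

/-- The threshold `M`: infimum of the levels `A` such that the set of points of `[0,1]` with mean
reward at least `A` has Lebesgue measure less than `p`. (This set of levels is an open half-line,
so the infimum is not attained.) -/
def threshold (m : ℝ → ℝ) (p : ℝ) : ℝ :=
  sInf {A : ℝ | volume {x : ℝ | x ∈ Set.Icc (0 : ℝ) 1 ∧ A ≤ m x} < ENNReal.ofReal p}

/-- `m` is weakly `L`-Lipschitz around the level `M` on `[0,1]`. -/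
def WeaklyLipschitz (m : ℝ → ℝ) (M L : ℝ) : Prop :=
  ∀ x ∈ Set.Icc (0 : ℝ) 1, ∀ y ∈ Set.Icc (0 : ℝ) 1,
    |m x - m y| ≤ max |M - m x| (L * |x - y|)

/-- Margin condition with constant `Q` around the level `M`. -/
def MarginCondition (m : ℝ → ℝ) (M Q : ℝ) : Prop :=
  ∀ ε ∈ Set.Ioo (0 : ℝ) 1,
    volume {x : ℝ | x ∈ Set.Icc (0 : ℝ) 1 ∧ |M - m x| ≤ ε} ≤ ENNReal.ofReal (Q * ε)

/-! ### The finite continuum-armed bandit -/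

/-- The model: `N` arms with i.i.d. covariates `a i`, uniform on `[0,1]`; conditionally on all the
covariates, the rewards `y i` are independent, take values in `[0,1]` and have mean `m (a i)`. -/
structure IsModel {Ω : Type*} [MeasurableSpace Ω] (μ : Measure Ω) [IsFiniteMeasure μ] {N : ℕ}
    (m : ℝ → ℝ) (a y : Fin N → Ω → ℝ) : Prop where
  measurable_covariate : ∀ i, Measurable (a i)
  measurable_reward : ∀ i, Measurable (y i)
  indep_covariate : iIndepFun a μ
  uniform_covariate : ∀ i, pdf.IsUniform (a i) (Set.Icc (0 : ℝ) 1) μ volume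
  reward_mem : ∀ i, ∀ᵐ ω ∂μ, y i ω ∈ Set.Icc (0 : ℝ) 1
  reward_law : ∀ᵐ x ∂(μ.map fun ω i => a i ω),
    ∃ η : Fin N → ProbabilityMeasure ℝ,
      condDistrib (fun ω i => y i ω) (fun ω i => a i ω) μ x
        = Measure.pi (fun i => (η i : Measure ℝ)) ∧
      ∀ i, ∫ z, z ∂(η i : Measure ℝ) = m (x i)

/-- Regret of pulling the arms `φ 0, …, φ (T-1)`, with respect to the oracle that pulls the first
`T` arms in an ordering of the arms by decreasing mean reward. Here `x i` is the covariate of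
arm `i`. -/
def regret {N T : ℕ} (m : ℝ → ℝ) (x : Fin N → ℝ) (φ : Fin T → Fin N) : ℝ :=
  (∑ t ∈ (Finset.univ : Finset (Fin N)).filter (fun t : Fin N => (t : ℕ) < T),
      m (x (Tuple.sort (fun i => - m (x i)) t)))
    - ∑ t : Fin T, m (x (φ t))

/-! ### The algorithm UCBF

Steps are numbered from `0`: `φ t` is the arm pulled after the `t` arms `φ s`, `s < t`. -/

/-- The `K` intervals `[k/K, (k+1)/K)`, `0 ≤ k < K`, the last one being closed. -/
def cell (K : ℕ) (k : Fin K) : Set ℝ :=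
  if (k : ℕ) + 1 = K then Set.Icc ((k : ℝ) / K) 1
  else Set.Ico ((k : ℝ) / K) (((k : ℝ) + 1) / K)

section Algorithm

variable {N T K : ℕ}

open Classical in
/-- The arms whose covariate lies in the `k`-th interval. -/
def armsIn (x : Fin N → ℝ) (k : Fin K) : Finset (Fin N) :=
  {i | x i ∈ cell K k}

open Classical in
/-- The steps before step `t` at which an arm of the `k`-th interval is pulled. -/
def pullTimes (x : Fin N → ℝ) (φ : Fin T → Fin N) (t : Fin T) (k : Fin K) : Finset (Fin T) :=
  {s | s < t ∧ x (φ s) ∈ cell K k}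

open Classical in
/-- The arms of the `k`-th interval that have not been pulled before step `t`. -/
def remaining (x : Fin N → ℝ) (φ : Fin T → Fin N) (t : Fin T) (k : Fin K) : Finset (Fin N) :=
  {i | x i ∈ cell K k ∧ ∀ s < t, φ s ≠ i}

/-- An interval is alive if it contained at least two arms at the start and still contains an arm
that has not been pulled. -/
def Alive (x : Fin N → ℝ) (φ : Fin T → Fin N) (t : Fin T) (k : Fin K) : Prop :=
  2 ≤ (armsIn x k).card ∧ (remaining x φ t k).Nonempty

/-- Average reward obtained before step `t` in the `k`-th interval. -/
def empMean (x z : Fin N → ℝ) (φ : Fin T → Fin N) (t : Fin T) (k : Fin K) : ℝ :=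
  (∑ s ∈ pullTimes x φ t k, z (φ s)) / (pullTimes x φ t k).card

/-- The upper confidence index of the `k`-th interval (used only if an arm of this interval has
been pulled before). -/
def ucb (δ : ℝ) (x z : Fin N → ℝ) (φ : Fin T → Fin N) (t : Fin T) (k : Fin K) : ℝ :=
  empMean x z φ t k + Real.sqrt (Real.log (T / δ) / (2 * (pullTimes x φ t k).card))

/-- `k` is a legitimate choice of interval at step `t`: an alive interval which, as long as some
alive interval has never been sampled (initialisation), is one of these, and afterwards maximises
the index among the alive intervals. Ties are broken arbitrarily. -/
def IsChoice (δ : ℝ) (x z : Fin N → ℝ) (φ : Fin T → Fin N) (t : Fin T) (k : Fin K) : Prop :=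
  Alive x φ t k ∧
    (pullTimes x φ t k = ∅ ∨
      ∀ j : Fin K, Alive x φ t j →
        (pullTimes x φ t j).Nonempty ∧ ucb δ x z φ t j ≤ ucb δ x z φ t k)

variable {Ω : Type*} [MeasurableSpace Ω]

/-- The σ-algebra generated by all covariates and rewards, the arms pulled before step `t`, and the
intervals selected up to and including step `t`. -/
@[reducible] def beforeDraw (a y : Fin N → Ω → ℝ) (φ : Fin T → Ω → Fin N) (κ : Fin T → Ω → Fin K)
    (t : Fin T) : MeasurableSpace Ω :=
  MeasurableSpace.comap
    (fun ω => ((fun i => a i ω, fun i => y i ω),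
      (fun s : {s : Fin T // s < t} => φ s ω, fun s : {s : Fin T // s ≤ t} => κ s ω)) :
      Ω → ((Fin N → ℝ) × (Fin N → ℝ)) ×
        (({s : Fin T // s < t} → Fin N) × ({s : Fin T // s ≤ t} → Fin K)))
    inferInstance

open Classical in
/-- `φ` is the sequence of arms pulled, and `κ` the sequence of intervals selected, in a run of UCBF
with parameters `K, δ` and budget `T`. Each arm is pulled at most once. While some interval is alive,
an interval is selected by the rule `IsChoice`, and the arm pulled is drawn uniformly at random among
the remaining arms of this interval: given everything that precedes the draw, and given the rewards
(which the draw does not look at), each remaining arm has the same probability. Nothing more is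
required in the degenerate case where no interval is alive any more before step `T`. -/
structure IsUCBFRun (μ : Measure Ω) (δ : ℝ) (a y : Fin N → Ω → ℝ)
    (φ : Fin T → Ω → Fin N) (κ : Fin T → Ω → Fin K) : Prop where
  measurable_arm : ∀ t, Measurable (φ t)
  measurable_interval : ∀ t, Measurable (κ t)
  injective : ∀ᵐ ω ∂μ, Function.Injective fun t => φ t ω
  choice : ∀ t, ∀ᵐ ω ∂μ,
    (∃ k : Fin K, Alive (fun i => a i ω) (fun s => φ s ω) t k) →
      IsChoice δ (fun i => a i ω) (fun i => y i ω) (fun s => φ s ω) t (κ t ω)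
  draw : ∀ t i, ∀ᵐ ω ∂μ,
    Alive (fun j => a j ω) (fun s => φ s ω) t (κ t ω) →
      (μ[Set.indicator {ω' | φ t ω' = i} (fun _ => (1 : ℝ)) | beforeDraw a y φ κ t]) ω
        = if i ∈ remaining (fun j => a j ω) (fun s => φ s ω) t (κ t ω)
          then (1 : ℝ) / (remaining (fun j => a j ω) (fun s => φ s ω) t (κ t ω)).card else 0

end Algorithm

/-- The number of intervals `⌊N^{1/3} log(N)^{-2/3}⌋`. -/
def numCells (N : ℕ) : ℕ :=
  ⌊(N : ℝ) ^ (1 / 3 : ℝ) * Real.log N ^ (-(2 / 3) : ℝ)⌋₊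

end FCAB

end

noncomputable section

namespace FCAB

/-! ### Geometry of the cells -/

section Cells

variable {K : ℕ} {k j : Fin K} {x y : ℝ}

/-! Measured against the level `M`, the regret is at most the deficits of the pulled arms below `M`
plus the excesses of the unpulled arms above it (`regret_le_levelLoss`). The cells are sorted by
their gap to `M`, with cut-off `c / K`, `c` a multiple of `L + 1`. By the weak Lipschitz condition a
cell with a larger gap lies on one side of `M`.

Near cells: the margin condition leaves a bounded number of them, each with `O(N / K)` arms of loss
`O(1 / K)`, so they cost `O(N / K ^ 2)`. Far cells below `M`: some cell at least about as good as
`M` is always alive (`exists_alive_above`), so the usual UCB argument allows only `O(log / gap ^ 2)`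
pulls in a cell of given gap. The margin condition bounds the sum of the `log / gap` by `O(K log K
log)`. Far cells above `M`: they are exhausted and cost nothing (`exhausted_of_far`). If one kept an
unpulled arm, it would compete forever, and the cells not clearly above `M` would receive only `O(K
^ 2 log)` pulls. The remaining cells hold at most `T - 3 N / (4 K)` arms, so fewer than `T` pulls
would take place. The slack of order `N / K` comes from one extra cell next to the crossing of the
level (`card_cellsAbove_ge`).

All this is deterministic on the event `IsGoodRun`. Its probabilistic core is that rewards within a
cell are sampled without replacement, adaptively in time. The average of the arms left is a
martingale, and an exponential supermartingale built on it (`sum_samplePotential_erase_le`) yields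
Hoeffding's bound after a given number of pulls (`measureReal_pullDeviation_ge_le`). Hoeffding's
inequality given the covariates compares the average reward in a cell with its average mean
(`measureReal_reward_dev_le`), and another application controls the counts of arms.

With `K` of order `N ^ (1/3) * log N ^ (-2/3)` both contributions to the regret have the same order.
Small `N` is absorbed by the constant. -/

lemma cell_bounds (h : x ∈ cell K k) : (k : ℝ) / K ≤ x ∧ x ≤ ((k : ℝ) + 1) / K := by
  unfold cell at h
  split_ifs at h with hk
  · refine ⟨h.1, h.2.trans ?_⟩
    have : ((k : ℝ) + 1) = K := by exact_mod_cast hk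
    rw [this, div_self]
    have := k.pos
    positivity
  · exact ⟨h.1, h.2.le⟩

lemma cell_subset_unitInterval : cell K k ⊆ Set.Icc 0 1 := by
  intro x h
  have hb := cell_bounds h
  have hK : (0 : ℝ) < K := by exact_mod_cast k.pos
  refine ⟨le_trans (by positivity) hb.1, hb.2.trans ?_⟩
  rw [div_le_one hK]
  exact_mod_cast k.2

lemma dist_le_of_mem_cell (hx : x ∈ cell K k) (hy : y ∈ cell K k) : |x - y| ≤ 1 / K := by
  have h1 := cell_bounds hx
  have h2 := cell_bounds hy
  rw [add_div] at h1 h2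
  rw [abs_le]
  constructor <;> linarith

lemma dist_le_of_mem_cell_succ (hx : x ∈ cell K k) (hy : y ∈ cell K j)
    (h : (k : ℕ) + 1 = j) : |x - y| ≤ 2 / K := by
  have h1 := cell_bounds hx
  have h2 := cell_bounds hy
  have : (j : ℝ) = k + 1 := by exact_mod_cast h.symm
  rw [this] at h2
  rw [add_div, add_div, add_div] at h2
  rw [add_div] at h1
  have : (2 : ℝ) / K = 1 / K + 1 / K := by ring
  rw [abs_le]
  have : (0 : ℝ) ≤ 1 / K := by positivity
  constructor <;> linarith

lemma left_mem_cell : (k : ℝ) / K ∈ cell K k := by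
  have hK : (0 : ℝ) < K := by exact_mod_cast k.pos
  unfold cell
  split_ifs with hk
  · refine ⟨le_rfl, ?_⟩
    rw [div_le_one hK]
    exact_mod_cast k.2.le
  · exact ⟨le_rfl, by gcongr; linarith⟩

lemma exists_mem_cell (hK : 0 < K) (hx : x ∈ Set.Icc (0 : ℝ) 1) : ∃ k : Fin K, x ∈ cell K k := by
  have hK' : (0 : ℝ) < K := by exact_mod_cast hK
  by_cases h : ⌊x * K⌋₊ + 1 < K
  · refine ⟨⟨⌊x * K⌋₊, by omega⟩, ?_⟩
    unfold cell
    rw [if_neg (by simpa using h.ne)]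
    refine ⟨?_, ?_⟩
    · rw [div_le_iff₀ hK']
      exact Nat.floor_le (mul_nonneg hx.1 hK'.le)
    · rw [lt_div_iff₀ hK']
      exact Nat.lt_floor_add_one _
  · refine ⟨⟨K - 1, by omega⟩, ?_⟩
    unfold cell
    rw [if_pos (by simp; omega)]
    refine ⟨?_, hx.2⟩
    rw [div_le_iff₀ hK']
    refine le_trans ?_ (Nat.floor_le (mul_nonneg hx.1 hK'.le))
    have : K - 1 ≤ ⌊x * K⌋₊ := by omega
    exact_mod_cast this

lemma cell_unique (hj : x ∈ cell K j) (hk : x ∈ cell K k) : j = k := by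
  wlog hlt : j < k generalizing j k
  · rcases lt_trichotomy j k with h | h | h
    · exact this hj hk h
    · exact h
    · exact (this hk hj h).symm
  exfalso
  have hK : (0 : ℝ) < K := by exact_mod_cast k.pos
  have h2 := (cell_bounds hk).1
  unfold cell at hj
  have hlt' : (j : ℕ) < k := hlt
  rw [if_neg (by have := k.2; omega)] at hj
  have h1 := hj.2
  have : ((j : ℝ) + 1) / K ≤ k / K := by
    gcongr
    exact_mod_cast hlt'
  linarith

lemma measurableSet_cell : MeasurableSet (cell K k) := by
  unfold cell
  split_ifs
  · exact measurableSet_Icc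
  · exact measurableSet_Ico

lemma volume_cell : volume (cell K k) = ENNReal.ofReal (1 / K) := by
  have hK : (0 : ℝ) < K := by exact_mod_cast k.pos
  unfold cell
  split_ifs with h
  · have : ((k : ℝ) + 1) = K := by exact_mod_cast h
    rw [Real.volume_Icc]
    congr 1
    field_simp
    linarith
  · rw [Real.volume_Ico]
    congr 1
    ring

lemma volume_biUnion_cell (J : Finset (Fin K)) :
    volume (⋃ k ∈ J, cell K k) = ENNReal.ofReal (J.card / K) := by
  rw [measure_biUnion_finset]
  · simp only [volume_cell, Finset.sum_const, nsmul_eq_mul]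
    rw [div_eq_mul_one_div (J.card : ℝ), ENNReal.ofReal_mul (by positivity), ENNReal.ofReal_natCast]
  · intro i _ j _ hij
    rw [Function.onFun, Set.disjoint_left]
    intro x hi hj
    exact hij (cell_unique hi hj)
  · exact fun _ _ => measurableSet_cell

end Cells

/-! ### Structure of a weakly Lipschitz function around its threshold -/

section Structure

variable {m : ℝ → ℝ} {M L Q p : ℝ} {K : ℕ}

/-- Reflection exchanges the two sides of the level, so each estimate needs proof on one side only.
It also gives the count of cells below the level, with `1 - p` in place of `p`. -/
lemma WeaklyLipschitz.neg (h : WeaklyLipschitz m M L) :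
    WeaklyLipschitz (fun x => - m x) (-M) L := by
  intro x hx y hy
  have := h x hx y hy
  have e1 : |-m x - -m y| = |m x - m y| := by rw [← abs_neg]; congr 1; ring
  have e2 : |-M - -m x| = |M - m x| := by rw [← abs_neg]; congr 1; ring
  rwa [e1, e2]

lemma WeaklyLipschitz.gap_le (h : WeaklyLipschitz m M L) (hL : 0 ≤ L) {x y r : ℝ}
    (hx : x ∈ Set.Icc (0 : ℝ) 1) (hy : y ∈ Set.Icc (0 : ℝ) 1) (hr : |x - y| ≤ r) :
    |m y - M| ≤ |m x - M| + max |m x - M| (L * r) := by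
  have h1 := h x hx y hy
  have h2 : L * |x - y| ≤ L * r := by gcongr
  rw [abs_sub_comm M] at h1
  have h3 : |m y - M| ≤ |m x - M| + |m x - m y| := by
    have : m y - M = (m x - M) - (m x - m y) := by ring
    rw [this]
    exact abs_sub _ _
  have h4 : |m x - m y| ≤ max |m x - M| (L * r) := h1.trans (max_le_max le_rfl h2)
  linarith

/-- Points at distance at most `r` from a point whose gap exceeds `2 * L * r` lie on the same side
of the level, at a comparable gap. -/
lemma WeaklyLipschitz.far_of_pos (h : WeaklyLipschitz m M L) (hL : 0 ≤ L) {x y r : ℝ}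
    (hx : x ∈ Set.Icc (0 : ℝ) 1) (hy : y ∈ Set.Icc (0 : ℝ) 1) (hr : |x - y| ≤ r)
    (hfar : 2 * (L * r) < m x - M) :
    m x - M ≤ 2 * (m y - M) ∧ m y - M ≤ 2 * (m x - M) := by
  have h1 := h x hx y hy
  have h2 := h y hy x hx
  rw [abs_sub_comm y x] at h2
  have h3 : L * |x - y| ≤ L * r := by gcongr
  have h0 : 0 ≤ L * r := le_trans (by positivity) h3
  rw [abs_sub_comm M] at h1 h2
  have hpos : |m x - M| = m x - M := abs_of_nonneg (by linarith)
  -- The gap at `x` dominates `L * r`, so `m` drops by at most this gap and `y` stays on the same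
  -- side. Reading the condition from `y` then gives the reverse comparison.
  rw [hpos, max_eq_left (by linarith), abs_le] at h1
  have h4 : |m y - m x| ≤ max |m y - M| (L * r) := h2.trans (max_le_max le_rfl h3)
  have hge : 0 ≤ m y - M := by linarith
  rw [abs_of_nonneg hge, le_max_iff, abs_le, abs_le] at h4
  constructor
  · rcases h4 with h4 | h4 <;> linarith [h4.1]
  · linarith [h1.2]

lemma WeaklyLipschitz.far_of_neg (h : WeaklyLipschitz m M L) (hL : 0 ≤ L) {x y r : ℝ}
    (hx : x ∈ Set.Icc (0 : ℝ) 1) (hy : y ∈ Set.Icc (0 : ℝ) 1) (hr : |x - y| ≤ r)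
    (hfar : 2 * (L * r) < M - m x) :
    M - m x ≤ 2 * (M - m y) ∧ M - m y ≤ 2 * (M - m x) := by
  have := h.neg.far_of_pos hL hx hy hr (by linarith)
  constructor <;> linarith [this.1, this.2]

/-- If the level is crossed between two points, then both are close to the level. -/
lemma WeaklyLipschitz.sub_le_of_cross (h : WeaklyLipschitz m M L) (hL : 0 ≤ L) {x y r : ℝ}
    (hx : x ∈ Set.Icc (0 : ℝ) 1) (hy : y ∈ Set.Icc (0 : ℝ) 1) (hr : |x - y| ≤ r)
    (hMx : M ≤ m x) (hMy : m y < M) : m x - m y ≤ L * r := by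
  have h1 := h x hx y hy
  have h2 := h y hy x hx
  rw [abs_sub_comm y x, abs_sub_comm (m y)] at h2
  rw [abs_of_nonneg (by linarith)] at h1 h2
  rw [abs_sub_comm M, abs_of_nonneg (by linarith), le_max_iff] at h1
  rw [abs_of_nonneg (by linarith), le_max_iff] at h2
  have h3 : L * |x - y| ≤ L * r := by gcongr
  -- The first alternative would force `M ≤ m y`.
  rcases h1 with h1 | h1
  · linarith
  · linarith

/-- Otherwise membership would propagate along consecutive indices. The neighbour found here is the
source of the `+ 1` in `card_cellsAbove_ge`. -/
lemma exists_adjacent {U : Finset (Fin K)} (hne : U.Nonempty) (hU : U ≠ Finset.univ) :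
    ∃ i ∈ U, ∃ j ∉ U, (i : ℕ) + 1 = j ∨ (j : ℕ) + 1 = i := by
  by_contra! hcon
  apply hU
  have hiff : ∀ n (h : n + 1 < K),
      ((⟨n, by omega⟩ : Fin K) ∈ U ↔ (⟨n + 1, h⟩ : Fin K) ∈ U) := by
    intro n h
    constructor
    · intro h1
      by_contra h2
      exact (hcon _ h1 _ h2).1 rfl
    · intro h1
      by_contra h2
      exact (hcon _ h1 _ h2).2 rfl
  obtain ⟨i, hi⟩ := hne
  have hzero : ∀ n (h : n < K), ((⟨n, h⟩ : Fin K) ∈ U ↔ (⟨0, by omega⟩ : Fin K) ∈ U) := by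
    intro n
    induction n with
    | zero => intro h; rfl
    | succ n ih => intro h; rw [← ih (by omega), hiff n h]
  rw [Finset.eq_univ_iff_forall]
  intro j
  have h1 := hzero i i.2
  have h2 := hzero j j.2
  exact h2.2 (h1.1 hi)

open Classical in
/-- The cells on which `m` nowhere falls more than `2 * L / K` below the level `M`. -/
def cellsAbove (m : ℝ → ℝ) (M L : ℝ) (K : ℕ) : Finset (Fin K) :=
  {k | ∀ x ∈ cell K k, M - 2 * L / K ≤ m x}

lemma mem_cellsAbove {k : Fin K} :
    k ∈ cellsAbove m M L K ↔ ∀ x ∈ cell K k, M - 2 * L / K ≤ m x := by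
  simp [cellsAbove]

/-- Since the level is crossed continuously, the cells which are not below the level outnumber the
mass of the upper level set by at least one. -/
lemma card_cellsAbove_ge (h : WeaklyLipschitz m M L) (hL : 0 ≤ L) (hK : 0 < K)
    (hp : 0 < p) (hpK : p * K + 1 ≤ K)
    (hvol : ENNReal.ofReal p ≤ volume {x | x ∈ Set.Icc (0 : ℝ) 1 ∧ M ≤ m x}) :
    p * K + 1 ≤ (cellsAbove m M L K).card := by
  classical
  have hK' : (0 : ℝ) < K := by exact_mod_cast hK
  have hLK : L * (1 / K) ≤ 2 * L / K := by
    rw [mul_one_div]; gcongr; linarith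
  -- The cells of `U` cover the upper level set, hence number at least `p * K`. A neighbouring cell
  -- outside `U` is within `2 / K` of a point at or above the level, whence the tolerance `2 * L /
  -- K`.
  set U : Finset (Fin K) := {k | ∃ x ∈ cell K k, M ≤ m x} with hUdef
  have hUA : U ⊆ cellsAbove m M L K := by
    intro k hk
    obtain ⟨x, hx, hMx⟩ := (Finset.mem_filter.1 hk).2
    rw [mem_cellsAbove]
    intro y hy
    by_contra! hlt
    have : 0 ≤ 2 * L / K := by positivity
    have := h.sub_le_of_cross hL (cell_subset_unitInterval hx) (cell_subset_unitInterval hy)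
      (dist_le_of_mem_cell hx hy) hMx (by linarith)
    linarith
  have hcard : p * K ≤ U.card := by
    have h1 : {x | x ∈ Set.Icc (0 : ℝ) 1 ∧ M ≤ m x} ⊆ ⋃ k ∈ U, cell K k := by
      rintro x ⟨hx, hMx⟩
      obtain ⟨k, hk⟩ := exists_mem_cell hK hx
      simp only [Set.mem_iUnion]
      exact ⟨k, by simp [hUdef]; exact ⟨x, hk, hMx⟩, hk⟩
    have h2 := hvol.trans (measure_mono h1)
    rw [volume_biUnion_cell, ENNReal.ofReal_le_ofReal_iff (by positivity), le_div_iff₀ hK'] at h2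
    exact h2
  by_cases hU : U = Finset.univ
  · have := Finset.card_le_card hUA
    rw [hU, Finset.card_univ, Fintype.card_fin] at this
    have : (K : ℝ) ≤ (cellsAbove m M L K).card := by exact_mod_cast this
    linarith
  · have hne : U.Nonempty := by
      rw [← Finset.card_pos]
      have : (0 : ℝ) < U.card := lt_of_lt_of_le (by positivity) hcard
      exact_mod_cast this
    obtain ⟨i, hi, j, hj, hij⟩ := exists_adjacent hne hU
    have hjA : j ∈ cellsAbove m M L K := by
      obtain ⟨x, hx, hMx⟩ := (Finset.mem_filter.1 hi).2
      rw [mem_cellsAbove]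
      intro y hy
      have hyM : m y < M := by
        by_contra! hc
        exact hj (by simp [hUdef]; exact ⟨y, hy, hc⟩)
      have hd : |x - y| ≤ 2 / K := by
        rcases hij with hij | hij
        · exact dist_le_of_mem_cell_succ hx hy hij
        · rw [abs_sub_comm]; exact dist_le_of_mem_cell_succ hy hx hij
      have := h.sub_le_of_cross hL (cell_subset_unitInterval hx) (cell_subset_unitInterval hy)
        hd hMx hyM
      have e : L * (2 / K) = 2 * L / K := by ring
      linarith
    have hsub : insert j U ⊆ cellsAbove m M L K := by
      intro k hk
      rcases Finset.mem_insert.1 hk with rfl | hk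
      · exact hjA
      · exact hUA hk
    have := Finset.card_le_card hsub
    rw [Finset.card_insert_of_notMem hj] at this
    have : ((U.card : ℝ) + 1) ≤ (cellsAbove m M L K).card := by exact_mod_cast this
    linarith

/-- The gap of the left end point of a cell. -/
def cellGap (m : ℝ → ℝ) (M : ℝ) (K : ℕ) (k : Fin K) : ℝ := |m ((k : ℝ) / K) - M|

open Classical in
-- As `ε` dominates `L / K`, the gap at most doubles across such a cell, and the margin condition at
-- `2 * ε` bounds the total volume. When `2 * ε ≥ 1` that condition is silent, but the trivial bound
-- `K` suffices; this accounts for `Q + 1`.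
lemma card_cellGap_le (h : WeaklyLipschitz m M L) (hL : 0 ≤ L) (hQ : 0 ≤ Q) (hK : 0 < K)
    (hmargin : MarginCondition m M Q) {ε : ℝ} (hε : 0 < ε) (hLε : L / K ≤ ε) :
    ((Finset.univ.filter fun k : Fin K => cellGap m M K k ≤ ε).card : ℝ)
      ≤ 2 * (Q + 1) * K * ε := by
  have hK' : (0 : ℝ) < K := by exact_mod_cast hK
  set J := Finset.univ.filter fun k : Fin K => cellGap m M K k ≤ ε with hJ
  by_cases h1 : 2 * ε < 1
  · have hsub : (⋃ k ∈ J, cell K k) ⊆ {x | x ∈ Set.Icc (0 : ℝ) 1 ∧ |M - m x| ≤ 2 * ε} := by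
      intro x hx
      simp only [Set.mem_iUnion] at hx
      obtain ⟨k, hk, hx⟩ := hx
      have hk' : |m ((k : ℝ) / K) - M| ≤ ε := (Finset.mem_filter.1 hk).2
      refine ⟨cell_subset_unitInterval hx, ?_⟩
      have := h.gap_le hL (cell_subset_unitInterval (left_mem_cell (k := k)))
        (cell_subset_unitInterval hx) (dist_le_of_mem_cell left_mem_cell hx)
      rw [abs_sub_comm]
      have h2 : max |m ((k : ℝ) / K) - M| (L * (1 / K)) ≤ ε := max_le hk' (by rwa [mul_one_div])
      linarith
    have h2 := (measure_mono hsub).trans (hmargin (2 * ε) ⟨by linarith, h1⟩)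
    rw [volume_biUnion_cell, ENNReal.ofReal_le_ofReal_iff (by positivity), div_le_iff₀ hK'] at h2
    nlinarith [mul_pos hK' hε]
  · have h2 : (J.card : ℝ) ≤ K := by
      have := Finset.card_le_univ J
      rw [Fintype.card_fin] at this
      exact_mod_cast this
    have h3 : (K : ℝ) ≤ K * (2 * ε) := by nlinarith
    nlinarith [mul_pos hK' hε, mul_nonneg hQ (mul_pos hK' hε).le]

end Structure

/-! ### The threshold -/

section Threshold

variable {m : ℝ → ℝ} {p : ℝ}

/-- The admissible levels form an upper set which contains everything above `1` and, because `p <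
1`, nothing at or below `0`. -/
lemma threshold_mem (hp : p ∈ Set.Ioo (0 : ℝ) 1)
    (hm : ∀ x ∈ Set.Icc (0 : ℝ) 1, m x ∈ Set.Icc (0 : ℝ) 1) :
    (∀ A, A < threshold m p →
      ENNReal.ofReal p ≤ volume {x : ℝ | x ∈ Set.Icc (0 : ℝ) 1 ∧ A ≤ m x}) ∧
    (∀ A, threshold m p < A →
      volume {x : ℝ | x ∈ Set.Icc (0 : ℝ) 1 ∧ A ≤ m x} < ENNReal.ofReal p) ∧
    threshold m p ∈ Set.Icc (0 : ℝ) 1 := by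
  set S := {A : ℝ | volume {x : ℝ | x ∈ Set.Icc (0 : ℝ) 1 ∧ A ≤ m x} < ENNReal.ofReal p} with hS
  have hthr : threshold m p = sInf S := rfl
  have hpos : ∀ A ∈ S, 0 < A := by
    intro A hA
    by_contra! hA0
    have : {x : ℝ | x ∈ Set.Icc (0 : ℝ) 1 ∧ A ≤ m x} = Set.Icc 0 1 := by
      ext x
      exact ⟨fun h => h.1, fun h => ⟨h, hA0.trans (hm x h).1⟩⟩
    have hA' : volume {x : ℝ | x ∈ Set.Icc (0 : ℝ) 1 ∧ A ≤ m x} < ENNReal.ofReal p := hA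
    rw [this, Real.volume_Icc, sub_zero, ENNReal.ofReal_lt_ofReal_iff hp.1] at hA'
    linarith [hp.2]
  have hgt : ∀ A, 1 < A → A ∈ S := by
    intro A hA
    have : {x : ℝ | x ∈ Set.Icc (0 : ℝ) 1 ∧ A ≤ m x} = ∅ := by
      ext x
      simp only [Set.mem_ofPred_eq, Set.mem_empty_iff_false, iff_false, not_and, not_le]
      intro hx
      exact lt_of_le_of_lt (hm x hx).2 hA
    rw [hS, Set.mem_ofPred_eq, this, measure_empty]
    exact ENNReal.ofReal_pos.2 hp.1
  have hbdd : BddBelow S := ⟨0, fun A hA => (hpos A hA).le⟩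
  have hne : S.Nonempty := ⟨2, hgt 2 (by norm_num)⟩
  rw [hthr]
  refine ⟨?_, ?_, ?_, ?_⟩
  · intro A hA
    by_contra! h
    exact absurd (csInf_le hbdd h) (not_le.2 hA)
  · intro A hA
    obtain ⟨A', hA', hlt⟩ := exists_lt_of_csInf_lt hne hA
    refine lt_of_le_of_lt (measure_mono ?_) hA'
    rintro x ⟨hx, h⟩
    exact ⟨hx, hlt.le.trans h⟩
  · exact le_csInf hne fun A hA => (hpos A hA).le
  · refine le_of_forall_gt_imp_ge_of_dense fun A hA => csInf_le hbdd (hgt A hA)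

/-- Continuity of the measure from above, along the levels `M - 1 / (n + 1)`. -/
lemma volume_threshold_le (hp : p ∈ Set.Ioo (0 : ℝ) 1) (hmeas : Measurable m)
    (hm : ∀ x ∈ Set.Icc (0 : ℝ) 1, m x ∈ Set.Icc (0 : ℝ) 1) :
    ENNReal.ofReal p ≤ volume {x : ℝ | x ∈ Set.Icc (0 : ℝ) 1 ∧ threshold m p ≤ m x} := by
  have h1 := (threshold_mem hp hm).1
  set M := threshold m p
  have hInter : {x : ℝ | x ∈ Set.Icc (0 : ℝ) 1 ∧ M ≤ m x}
      = ⋂ n : ℕ, {x : ℝ | x ∈ Set.Icc (0 : ℝ) 1 ∧ M - 1 / ((n : ℝ) + 1) ≤ m x} := by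
    ext x
    simp only [Set.mem_ofPred_eq, Set.mem_iInter]
    constructor
    · rintro ⟨hx, h⟩ n
      have : (0 : ℝ) < 1 / ((n : ℝ) + 1) := by positivity
      exact ⟨hx, by linarith⟩
    · intro h
      refine ⟨(h 0).1, ?_⟩
      by_contra! hlt
      obtain ⟨n, hn⟩ := exists_nat_one_div_lt (sub_pos.2 hlt)
      linarith [(h n).2]
  rw [hInter, Antitone.measure_iInter]
  · refine le_iInf fun n => h1 _ ?_
    have : (0 : ℝ) < 1 / ((n : ℝ) + 1) := by positivity
    linarith
  · rintro i j hij x ⟨hx, h⟩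
    refine ⟨hx, le_trans ?_ h⟩
    have : 1 / ((j : ℝ) + 1) ≤ 1 / ((i : ℝ) + 1) := by gcongr
    linarith
  · intro n
    exact (measurableSet_Icc.inter (measurableSet_le measurable_const hmeas)).nullMeasurableSet
  · refine ⟨0, ne_top_of_le_ne_top ?_ (measure_mono (t := Set.Icc (0 : ℝ) 1) fun x hx => hx.1)⟩
    simp

/-- Continuity from below gives mass at most `p` to `M < m`; take complements. The signs are
arranged so that `card_cellsAbove_ge` applies to `-m`. -/
lemma le_volume_le_threshold (hp : p ∈ Set.Ioo (0 : ℝ) 1)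
    (hm : ∀ x ∈ Set.Icc (0 : ℝ) 1, m x ∈ Set.Icc (0 : ℝ) 1) :
    ENNReal.ofReal (1 - p)
      ≤ volume {x : ℝ | x ∈ Set.Icc (0 : ℝ) 1 ∧ -threshold m p ≤ - m x} := by
  have h1 := (threshold_mem hp hm).2.1
  set M := threshold m p
  have hUnion : {x : ℝ | x ∈ Set.Icc (0 : ℝ) 1 ∧ M < m x}
      = ⋃ n : ℕ, {x : ℝ | x ∈ Set.Icc (0 : ℝ) 1 ∧ M + 1 / ((n : ℝ) + 1) ≤ m x} := by
    ext x
    simp only [Set.mem_ofPred_eq, Set.mem_iUnion]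
    constructor
    · rintro ⟨hx, h⟩
      obtain ⟨n, hn⟩ := exists_nat_one_div_lt (sub_pos.2 h)
      exact ⟨n, hx, by linarith⟩
    · rintro ⟨n, hx, h⟩
      have : (0 : ℝ) < 1 / ((n : ℝ) + 1) := by positivity
      exact ⟨hx, by linarith⟩
  have hle : volume {x : ℝ | x ∈ Set.Icc (0 : ℝ) 1 ∧ M < m x} ≤ ENNReal.ofReal p := by
    rw [hUnion, Monotone.measure_iUnion]
    · refine iSup_le fun n => (h1 _ ?_).le
      have : (0 : ℝ) < 1 / ((n : ℝ) + 1) := by positivity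
      linarith
    · rintro i j hij x ⟨hx, h⟩
      refine ⟨hx, le_trans ?_ h⟩
      have : 1 / ((j : ℝ) + 1) ≤ 1 / ((i : ℝ) + 1) := by gcongr
      linarith
  have hcover : Set.Icc (0 : ℝ) 1 ⊆ {x : ℝ | x ∈ Set.Icc (0 : ℝ) 1 ∧ M < m x} ∪
      {x : ℝ | x ∈ Set.Icc (0 : ℝ) 1 ∧ -M ≤ - m x} := by
    intro x hx
    rcases lt_or_ge M (m x) with h | h
    · exact Or.inl ⟨hx, h⟩
    · exact Or.inr ⟨hx, by linarith⟩
  have h2 := (measure_mono hcover).trans (measure_union_le (μ := volume) _ _)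
  rw [Real.volume_Icc, sub_zero] at h2
  rw [ENNReal.ofReal_sub _ hp.1.le, tsub_le_iff_left]
  exact h2.trans (by gcongr)

end Threshold

/-! ### Sampling without replacement -/

/-- Hoeffding's lemma for the uniform distribution on a finite set. -/
lemma sum_exp_le_of_mem_Icc {ι : Type*} (R : Finset ι) (z : ι → ℝ)
    (hz : ∀ i ∈ R, z i ∈ Set.Icc (0 : ℝ) 1) (θ : ℝ) :
    ∑ i ∈ R, Real.exp (θ * (z i - (∑ j ∈ R, z j) / R.card)) ≤
      R.card * Real.exp (θ ^ 2 / 8) := by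
  classical
  rcases R.eq_empty_or_nonempty with rfl | hne
  · simp
  have hcard : (0 : ℝ) < R.card := by exact_mod_cast hne.card_pos
  let _ : MeasurableSpace R := ⊤
  have : MeasurableSingletonClass R := ⟨fun _ => trivial⟩
  have : Nonempty R := hne.to_subtype
  set ν : Measure R := uniformOn Set.univ with hν
  have : IsProbabilityMeasure ν := isProbabilityMeasure_uniformOn Set.finite_univ Set.univ_nonempty
  have hint : ∀ f : R → ℝ, ∫ i, f i ∂ν = (∑ i ∈ R.attach, f i) / R.card := by
    intro f
    rw [integral_fintype (Integrable.of_finite), Finset.sum_div]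
    refine Finset.sum_congr rfl fun i _ => ?_
    have : ν.real {i} = 1 / R.card := by
      rw [Measure.real, hν, uniformOn_univ, Measure.count_singleton]
      simp
    rw [this, smul_eq_mul]
    ring
  have hsub := hasSubgaussianMGF_of_mem_Icc (μ := ν) (X := fun i : R => z i) (a := 0) (b := 1)
    (Measurable.of_discrete).aemeasurable (Filter.Eventually.of_forall fun i => hz i i.2)
  have h := hsub.mgf_le θ
  rw [mgf, hint, hint, R.sum_attach (fun i => z i)] at h
  rw [R.sum_attach (fun i => Real.exp (θ * (z i - (∑ j ∈ R, z j) / R.card))),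
    div_le_iff₀ hcard, mul_comm] at h
  refine h.trans (le_of_eq ?_)
  congr 2
  simp
  ring

/-- The exponential potential attached to the set `R` of the arms left from a population of size
`n₀` and average reward `ybar`. -/
def samplePotential {N : ℕ} (s ybar : ℝ) (n₀ g : ℕ) (z : Fin N → ℝ) (R : Finset (Fin N)) : ℝ :=
  Real.exp (s * g * (ybar - (∑ i ∈ R, z i) / R.card) - ((n₀ : ℝ) - R.card) * s ^ 2 / 8)

/-- Removing `i` shifts the average over `R` by its difference with `z i` divided by `R.card - 1`.
If `R.card = 1` then `g = 0`, and the division by zero is harmless. -/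
lemma samplePotential_erase {N : ℕ} {s ybar : ℝ} {n₀ g : ℕ} {z : Fin N → ℝ} {R : Finset (Fin N)}
    (hg : g < R.card) {i : Fin N} (hi : i ∈ R) :
    samplePotential s ybar n₀ g z (R.erase i) =
      samplePotential s ybar n₀ g z R * Real.exp (-(s ^ 2 / 8)) *
        Real.exp (s * g / (R.card - 1) * (z i - (∑ j ∈ R, z j) / R.card)) := by
  have hc : ((R.erase i).card : ℝ) = R.card - 1 := by
    rw [Finset.card_erase_of_mem hi, Nat.cast_sub (by omega)]
    simp
  have hs : ∑ j ∈ R.erase i, z j = ∑ j ∈ R, z j - z i := by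
    rw [← Finset.sum_erase_add R z hi]; ring
  have key : s * g * (ybar - (∑ j ∈ R, z j - z i) / (R.card - 1)) =
      s * g * (ybar - (∑ j ∈ R, z j) / R.card) +
        s * g / (R.card - 1) * (z i - (∑ j ∈ R, z j) / R.card) := by
    rcases Nat.eq_zero_or_pos g with rfl | hg0
    · simp
    · have h2 : (2 : ℝ) ≤ R.card := by exact_mod_cast (by omega : 2 ≤ R.card)
      have h3 : (R.card : ℝ) - 1 ≠ 0 := by linarith
      have h4 : (R.card : ℝ) ≠ 0 := by linarith
      field_simp
      ring
  unfold samplePotential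
  rw [hc, hs, key, ← Real.exp_add, ← Real.exp_add]
  congr 1
  ring

/-- The supermartingale step. Since `g ≤ R.card - 1`, the centred increment has coefficient at most
`|s|` in absolute value, and the factor `exp (-(s ^ 2 / 8))` pays for Hoeffding's lemma. -/
lemma sum_samplePotential_erase_le {N : ℕ} {s ybar : ℝ} {n₀ g : ℕ} {z : Fin N → ℝ}
    {R : Finset (Fin N)} (hz : ∀ i ∈ R, z i ∈ Set.Icc (0 : ℝ) 1) (hg : g < R.card) :
    ∑ i, samplePotential s ybar n₀ g z (R.erase i) * (if i ∈ R then (1 : ℝ) / R.card else 0) ≤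
      samplePotential s ybar n₀ g z R := by
  have hcard : (0 : ℝ) < R.card := by exact_mod_cast (by omega : 0 < R.card)
  have h1 : ∑ i, samplePotential s ybar n₀ g z (R.erase i) *
        (if i ∈ R then (1 : ℝ) / R.card else 0) =
      ∑ i ∈ R, (samplePotential s ybar n₀ g z R * Real.exp (-(s ^ 2 / 8)) *
        Real.exp (s * g / (R.card - 1) * (z i - (∑ j ∈ R, z j) / R.card))) * (1 / R.card) := by
    simp only [mul_ite, mul_zero]
    rw [← Finset.sum_filter, Finset.filter_univ_mem]
    exact Finset.sum_congr rfl fun i hi => by rw [samplePotential_erase hg hi]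
  rw [h1, ← Finset.sum_mul, ← Finset.mul_sum]
  set θ := s * g / (R.card - 1) with hθ
  have hθ2 : θ ^ 2 ≤ s ^ 2 := by
    rcases Nat.eq_zero_or_pos g with rfl | hg0
    · simp [hθ]; positivity
    · have h2 : (0 : ℝ) < (R.card : ℝ) - 1 := by
        have : (2 : ℝ) ≤ R.card := by exact_mod_cast (by omega : 2 ≤ R.card)
        linarith
      have h3 : (g : ℝ) ≤ (R.card : ℝ) - 1 := by
        have : (g : ℝ) + 1 ≤ R.card := by exact_mod_cast hg
        linarith
      have h4 : ((g : ℝ) / (R.card - 1)) ^ 2 ≤ 1 := by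
        rw [sq_le_one_iff₀ (by positivity)]
        exact (div_le_one h2).2 h3
      have : θ ^ 2 = s ^ 2 * ((g : ℝ) / (R.card - 1)) ^ 2 := by rw [hθ]; ring
      rw [this]
      nlinarith [sq_nonneg s]
  have h5 := sum_exp_le_of_mem_Icc R z hz θ
  have hpos : 0 < samplePotential s ybar n₀ g z R := Real.exp_pos _
  have h6 : ∑ i ∈ R, Real.exp (θ * (z i - (∑ j ∈ R, z j) / R.card)) ≤
      R.card * Real.exp (s ^ 2 / 8) :=
    h5.trans (by gcongr)
  calc samplePotential s ybar n₀ g z R * Real.exp (-(s ^ 2 / 8)) *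
        (∑ i ∈ R, Real.exp (θ * (z i - (∑ j ∈ R, z j) / R.card))) * (1 / R.card)
      ≤ samplePotential s ybar n₀ g z R * Real.exp (-(s ^ 2 / 8)) *
        (R.card * Real.exp (s ^ 2 / 8)) * (1 / R.card) := by gcongr
    _ = samplePotential s ybar n₀ g z R * (Real.exp (-(s ^ 2 / 8)) * Real.exp (s ^ 2 / 8)) := by
        field_simp
    _ = _ := by rw [← Real.exp_add]; simp

/-- Integrating a function of a random index whose conditional probabilities are known. -/
lemma setIntegral_comp_draw {Ω : Type*} {m m₀ : MeasurableSpace Ω} (hm : m ≤ m₀)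
    {μ : Measure[m₀] Ω} [IsProbabilityMeasure μ] {N : ℕ} {φ : Ω → Fin N} (hφ : Measurable[m₀] φ)
    {A : Set Ω} (hA : MeasurableSet[m] A) {q : Fin N → Ω → ℝ}
    (hq : ∀ i, ∀ᵐ ω ∂μ, ω ∈ A →
      (μ[Set.indicator {ω' | φ ω' = i} (fun _ => (1 : ℝ)) | m]) ω = q i ω)
    {G : Fin N → Ω → ℝ} (hG : ∀ i, Measurable[m] (G i)) {c : ℝ} (hc : ∀ i ω, |G i ω| ≤ c) :
    IntegrableOn (fun ω => ∑ i, G i ω * q i ω) A μ ∧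
    ∫ ω in A, G (φ ω) ω ∂μ = ∫ ω in A, ∑ i, G i ω * q i ω ∂μ := by
  classical
  set e : Fin N → Ω → ℝ := fun i => Set.indicator {ω' | φ ω' = i} (fun _ => (1 : ℝ)) with he
  have hms : ∀ i, MeasurableSet[m₀] {ω' | φ ω' = i} := fun i =>
    hφ (measurableSet_singleton i)
  have heint : ∀ i, Integrable (e i) μ := fun i =>
    (integrable_const (1 : ℝ)).indicator (hms i)
  have hpull : ∀ i, μ[G i * e i | m] =ᵐ[μ] G i * μ[e i | m] := fun i =>
    condExp_stronglyMeasurable_mul_of_bound hm (hG i).stronglyMeasurable (heint i) c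
      (Filter.Eventually.of_forall fun ω => hc i ω)
  have hGe : ∀ i, Integrable (G i * e i) μ := fun i =>
    (heint i).bdd_mul ((hG i).mono hm le_rfl).aestronglyMeasurable
      (Filter.Eventually.of_forall fun ω => hc i ω)
  have hAm : MeasurableSet[m₀] A := hm A hA
  have hae : ∀ i, (fun ω => G i ω * q i ω) =ᵐ[μ.restrict A] μ[G i * e i | m] := by
    intro i
    rw [Filter.EventuallyEq, ae_restrict_iff' hAm]
    filter_upwards [hq i, hpull i] with ω h1 h2 hωA
    rw [h2, Pi.mul_apply, h1 hωA]
  have hint : ∀ i, IntegrableOn (fun ω => G i ω * q i ω) A μ := fun i =>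
    (integrable_condExp.integrableOn (s := A)).congr (hae i).symm
  refine ⟨integrable_finsetSum _ fun i _ => hint i, ?_⟩
  rw [integral_finsetSum _ fun i _ => hint i]
  have h1 : ∀ ω, G (φ ω) ω = ∑ i, (G i * e i) ω := by
    intro ω
    simp [he, Set.indicator_apply]
  simp_rw [h1]
  rw [integral_finsetSum _ fun i _ => (hGe i).integrableOn]
  refine Finset.sum_congr rfl fun i _ => ?_
  rw [integral_congr_ae (hae i), setIntegral_condExp hm (hGe i) hA]

/-! ### The unpulled arms of an interval, stopped at a prescribed size -/

section Stopped

variable {N T K : ℕ}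

open Classical in
/-- The arms left in the `k`-th interval after the first `t` steps, frozen as soon as only `g` of
them are left. -/
def stoppedLeft (x : Fin N → ℝ) (φ : Fin T → Fin N) (κ : Fin T → Fin K) (k : Fin K) (g : ℕ) :
    ℕ → Finset (Fin N)
  | 0 => armsIn x k
  | t + 1 =>
    if h : ∃ h : t < T, Alive x φ ⟨t, h⟩ k ∧ κ ⟨t, h⟩ = k ∧ g < (stoppedLeft x φ κ k g t).card ∧
        stoppedLeft x φ κ k g t = remaining x φ ⟨t, h⟩ k
    then (stoppedLeft x φ κ k g t).erase (φ ⟨t, h.1⟩)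
    else stoppedLeft x φ κ k g t

/-- The condition under which the stopped set of arms left loses an arm at step `t`. -/
def ActiveStep (x : Fin N → ℝ) (φ : Fin T → Fin N) (κ : Fin T → Fin K) (k : Fin K) (g : ℕ)
    (t : Fin T) : Prop :=
  Alive x φ t k ∧ κ t = k ∧ g < (stoppedLeft x φ κ k g t).card ∧
    stoppedLeft x φ κ k g t = remaining x φ t k

lemma stoppedLeft_succ_of_active {x : Fin N → ℝ} {φ : Fin T → Fin N} {κ : Fin T → Fin K}
    {k : Fin K} {g : ℕ} {t : Fin T} (h : ActiveStep x φ κ k g t) :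
    stoppedLeft x φ κ k g (t + 1) = (stoppedLeft x φ κ k g t).erase (φ t) := by
  rw [stoppedLeft, dif_pos ⟨t.2, h⟩]

lemma stoppedLeft_succ_of_not_active {x : Fin N → ℝ} {φ : Fin T → Fin N} {κ : Fin T → Fin K}
    {k : Fin K} {g : ℕ} {t : Fin T} (h : ¬ ActiveStep x φ κ k g t) :
    stoppedLeft x φ κ k g (t + 1) = stoppedLeft x φ κ k g t := by
  rw [stoppedLeft, dif_neg]
  rintro ⟨_, h'⟩
  exact h h'

end Stopped

/-! ### The exponential supermartingale along a run -/

section Supermartingale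

variable {N T K : ℕ} {Ω : Type*}

lemma measurable_finset {m : MeasurableSpace Ω} {X : Ω → Finset (Fin N)}
    (h : ∀ i, MeasurableSet {ω | i ∈ X ω}) : Measurable[m, ⊤] X := by
  let _ : MeasurableSpace (Finset (Fin N)) := ⊤
  refine measurable_to_countable' fun R => ?_
  have : X ⁻¹' {R} = ⋂ i, {ω | i ∈ X ω ↔ i ∈ R} := by
    ext ω
    simp [Finset.ext_iff]
  rw [this]
  refine MeasurableSet.iInter fun i => ?_
  by_cases hi : i ∈ R
  · simpa [hi] using h i
  · convert (h i).compl using 1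
    ext ω
    simp [hi]

lemma measurable_armsIn {m : MeasurableSpace Ω} {a : Fin N → Ω → ℝ} (ha : ∀ i, Measurable (a i))
    (k : Fin K) : Measurable[m, ⊤] fun ω => armsIn (fun i => a i ω) k := by
  refine measurable_finset fun i => ?_
  have : {ω | i ∈ armsIn (fun i => a i ω) k} = a i ⁻¹' cell K k := by
    ext ω
    simp [armsIn]
  rw [this]
  exact ha i measurableSet_cell

lemma measurable_remaining {m : MeasurableSpace Ω} {a : Fin N → Ω → ℝ} {φ : Fin T → Ω → Fin N}
    (ha : ∀ i, Measurable (a i)) (t : Fin T) (hφ : ∀ s < t, Measurable (φ s)) (k : Fin K) :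
    Measurable[m, ⊤] fun ω => remaining (fun i => a i ω) (fun s => φ s ω) t k := by
  refine measurable_finset fun i => ?_
  have : {ω | i ∈ remaining (fun i => a i ω) (fun s => φ s ω) t k} =
      a i ⁻¹' cell K k ∩ ⋂ s, ⋂ (_ : s < t), (φ s ⁻¹' {i})ᶜ := by
    ext ω
    simp [remaining]
  rw [this]
  exact (ha i measurableSet_cell).inter (MeasurableSet.iInter fun s => MeasurableSet.iInter fun hs =>
    (hφ s hs (measurableSet_singleton i)).compl)

lemma measurableSet_rel {m : MeasurableSpace Ω} {X Y : Ω → Finset (Fin N)}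
    (hX : Measurable[m, ⊤] X) (hY : Measurable[m, ⊤] Y) (P : Finset (Fin N) → Finset (Fin N) → Prop) :
    MeasurableSet {ω | P (X ω) (Y ω)} := by
  let _ : MeasurableSpace (Finset (Fin N)) := ⊤
  exact (hX.prodMk hY) (MeasurableSet.of_discrete (s := {q | P q.1 q.2}))

lemma measurableSet_alive {m : MeasurableSpace Ω} {a : Fin N → Ω → ℝ} {φ : Fin T → Ω → Fin N}
    (ha : ∀ i, Measurable (a i)) (t : Fin T) (hφ : ∀ s < t, Measurable (φ s)) (k : Fin K) :
    MeasurableSet {ω | Alive (fun i => a i ω) (fun s => φ s ω) t k} :=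
  measurableSet_rel (measurable_armsIn ha k) (measurable_remaining ha t hφ k)
    (fun A R => 2 ≤ A.card ∧ R.Nonempty)

/-- The stopped set of arms left, in a run observed at the outcome `ω`, when the `k`-th interval is
followed for `n` pulls. -/
def leftAfter (a : Fin N → Ω → ℝ) (φ : Fin T → Ω → Fin N) (κ : Fin T → Ω → Fin K) (k : Fin K)
    (n : ℕ) (t : ℕ) (ω : Ω) : Finset (Fin N) :=
  stoppedLeft (fun i => a i ω) (fun s => φ s ω) (fun s => κ s ω) k
    ((armsIn (fun i => a i ω) k).card - n) t

/-- The event that an arm is withdrawn from `leftAfter` at step `t`. -/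
def activeEvent (a : Fin N → Ω → ℝ) (φ : Fin T → Ω → Fin N) (κ : Fin T → Ω → Fin K) (k : Fin K)
    (n : ℕ) (t : Fin T) : Set Ω :=
  {ω | ActiveStep (fun i => a i ω) (fun s => φ s ω) (fun s => κ s ω) k
    ((armsIn (fun i => a i ω) k).card - n) t}

variable {a : Fin N → Ω → ℝ} {φ : Fin T → Ω → Fin N} {κ : Fin T → Ω → Fin K}

lemma leftAfter_succ (k : Fin K) (n : ℕ) (t : Fin T) (ω : Ω) [Decidable (ω ∈ activeEvent a φ κ k n t)] :
    leftAfter a φ κ k n (t + 1) ω =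
      if ω ∈ activeEvent a φ κ k n t then (leftAfter a φ κ k n t ω).erase (φ t ω)
      else leftAfter a φ κ k n t ω := by
  split_ifs with h
  · exact stoppedLeft_succ_of_active h
  · exact stoppedLeft_succ_of_not_active h

lemma measurableSet_activeEvent_of {m : MeasurableSpace Ω} (ha : ∀ i, Measurable (a i))
    (k : Fin K) (n : ℕ) (t : Fin T) (hφ : ∀ s < t, Measurable (φ s)) (hκ : Measurable (κ t))
    (hleft : Measurable[m, ⊤] (leftAfter a φ κ k n t)) :
    MeasurableSet (activeEvent a φ κ k n t) := by
  have h1 := measurableSet_alive ha t hφ k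
  have h2 : MeasurableSet {ω | κ t ω = k} := hκ (measurableSet_singleton k)
  have h3 := measurableSet_rel (measurable_armsIn ha k) hleft (fun A R => A.card - n < R.card)
  have h4 := measurableSet_rel hleft (measurable_remaining ha t hφ k) (fun A R => A = R)
  exact h1.inter (h2.inter (h3.inter h4))

/-- The σ-algebra is left free because two are needed: the ambient one for integrability, and
`beforeDraw`, for which the arm drawn at the current step need not be measurable. -/
lemma measurable_leftAfter {m : MeasurableSpace Ω} (ha : ∀ i, Measurable (a i))
    (k : Fin K) (n : ℕ) (t : ℕ) (ht : t ≤ T) (hφ : ∀ s : Fin T, (s : ℕ) < t → Measurable (φ s))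
    (hκ : ∀ s : Fin T, (s : ℕ) < t → Measurable (κ s)) :
    Measurable[m, ⊤] (leftAfter a φ κ k n t) := by
  classical
  let _ : MeasurableSpace (Finset (Fin N)) := ⊤
  induction t with
  | zero => exact measurable_armsIn ha k
  | succ t ih =>
    have ih' := ih (by omega) (fun s hs => hφ s (by omega)) (fun s hs => hκ s (by omega))
    have hE := measurableSet_activeEvent_of ha k n ⟨t, ht⟩
      (fun s hs => hφ s (lt_trans hs (Nat.lt_succ_self t))) (hκ _ (Nat.lt_succ_self t)) ih'
    have : leftAfter a φ κ k n (t + 1) = fun ω =>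
        if ω ∈ activeEvent a φ κ k n ⟨t, ht⟩ then
          (leftAfter a φ κ k n t ω).erase (φ ⟨t, ht⟩ ω) else leftAfter a φ κ k n t ω :=
      funext fun ω => leftAfter_succ k n ⟨t, ht⟩ ω
    rw [this]
    refine Measurable.ite hE ?_ ih'
    have h2 : Measurable (φ ⟨t, ht⟩) := hφ _ (Nat.lt_succ_self t)
    exact (Measurable.of_discrete (f := fun q : Finset (Fin N) × Fin N => q.1.erase q.2)).comp
      (ih'.prodMk h2)

/-- The potential followed along a run, for rewards `z`. -/
def runPotential (a z : Fin N → Ω → ℝ) (k : Fin K) (s : ℝ) (n : ℕ) (R : Finset (Fin N)) (ω : Ω) :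
    ℝ :=
  samplePotential s
    ((∑ i ∈ armsIn (fun i => a i ω) k, z i ω) / (armsIn (fun i => a i ω) k).card)
    (armsIn (fun i => a i ω) k).card ((armsIn (fun i => a i ω) k).card - n) (fun i => z i ω) R

lemma measurable_comp_finset {β : Type*} {m : MeasurableSpace Ω} [MeasurableSpace β]
    {X : Ω → Finset (Fin N)} (hX : Measurable[m, ⊤] X) {f : Finset (Fin N) → Ω → β}
    (hf : ∀ R, Measurable (f R)) : Measurable fun ω => f (X ω) ω := by
  intro S hS
  have h : (fun ω => f (X ω) ω) ⁻¹' S = ⋃ R, (X ⁻¹' {R} ∩ f R ⁻¹' S) := by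
    ext ω
    simp
  rw [h]
  exact MeasurableSet.iUnion fun R =>
    (hX (MeasurableSpace.measurableSet_top (s := {R}))).inter (hf R hS)

lemma measurable_runPotential {m : MeasurableSpace Ω} {z : Fin N → Ω → ℝ}
    (ha : ∀ i, Measurable (a i)) (hz : ∀ i, Measurable (z i)) (k : Fin K) (s : ℝ) (n : ℕ)
    (R : Finset (Fin N)) : Measurable (runPotential a z k s n R) := by
  have hsum : ∀ B : Finset (Fin N), Measurable fun ω => ∑ i ∈ B, z i ω :=
    fun B => Finset.measurable_fun_sum B fun i _ => hz i
  refine measurable_comp_finset (measurable_armsIn ha k)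
    (f := fun A ω => samplePotential s ((∑ i ∈ A, z i ω) / A.card) A.card (A.card - n)
      (fun i => z i ω) R) fun A => ?_
  exact Real.measurable_exp.comp (((((hsum A).div_const _).sub
    ((hsum R).div_const _)).const_mul _).sub_const _)

lemma measurable_runPotential_comp {m : MeasurableSpace Ω} {z : Fin N → Ω → ℝ}
    (ha : ∀ i, Measurable (a i)) (hz : ∀ i, Measurable (z i)) (k : Fin K) (s : ℝ) (n : ℕ)
    {R : Ω → Finset (Fin N)} (hR : Measurable[m, ⊤] R) :
    Measurable fun ω => runPotential a z k s n (R ω) ω :=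
  measurable_comp_finset hR fun R => measurable_runPotential ha hz k s n R

lemma average_mem_Icc {ι : Type*} (R : Finset ι) {z : ι → ℝ}
    (hz : ∀ i ∈ R, z i ∈ Set.Icc (0 : ℝ) 1) : (∑ i ∈ R, z i) / R.card ∈ Set.Icc (0 : ℝ) 1 := by
  refine ⟨div_nonneg (Finset.sum_nonneg fun i hi => (hz i hi).1) (by positivity), ?_⟩
  refine div_le_one_of_le₀ ?_ (by positivity)
  simpa using Finset.sum_le_card_nsmul R z 1 fun i hi => (hz i hi).2

/-- A crude bound, for integrability and for taking factors out of conditional expectations. -/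
lemma abs_runPotential_le {z : Fin N → Ω → ℝ} (hz : ∀ i ω, z i ω ∈ Set.Icc (0 : ℝ) 1)
    (k : Fin K) (s : ℝ) (n : ℕ) (R : Finset (Fin N)) (ω : Ω) :
    |runPotential a z k s n R ω| ≤ Real.exp (|s| * N + N * s ^ 2 / 8) := by
  rw [runPotential, samplePotential, abs_of_pos (Real.exp_pos _), Real.exp_le_exp]
  set A := armsIn (fun i => a i ω) k
  have h1 := average_mem_Icc A (z := fun i => z i ω) fun i _ => hz i ω
  have h2 := average_mem_Icc R (z := fun i => z i ω) fun i _ => hz i ω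
  have hcard : ∀ B : Finset (Fin N), (B.card : ℝ) ≤ N := by
    intro B
    have := Finset.card_le_univ B
    rw [Fintype.card_fin] at this
    exact_mod_cast this
  have h3 : ((A.card - n : ℕ) : ℝ) ≤ N := by
    refine le_trans ?_ (hcard A)
    exact_mod_cast Nat.sub_le _ _
  have h4 : s * ((A.card - n : ℕ) : ℝ) *
      ((∑ i ∈ A, z i ω) / A.card - (∑ i ∈ R, z i ω) / R.card) ≤ |s| * N := by
    refine (le_abs_self _).trans ?_
    rw [abs_mul, abs_mul, Nat.abs_cast]
    have h5 : |(∑ i ∈ A, z i ω) / A.card - (∑ i ∈ R, z i ω) / R.card| ≤ 1 := by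
      rw [abs_le]; constructor <;> linarith [h1.1, h1.2, h2.1, h2.2]
    calc |s| * ((A.card - n : ℕ) : ℝ) * _ ≤ |s| * N * 1 := by gcongr
      _ = _ := mul_one _
  have h6 : -(((A.card : ℝ) - R.card) * s ^ 2 / 8) ≤ N * s ^ 2 / 8 := by
    have := hcard R
    have h7 : (0 : ℝ) ≤ A.card := by positivity
    nlinarith [mul_nonneg (by linarith : 0 ≤ (N : ℝ) - R.card + A.card) (sq_nonneg s)]
  linarith

variable [MeasurableSpace Ω] {μ : Measure Ω} {y : Fin N → Ω → ℝ} {δ : ℝ}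

lemma beforeDraw_le (ha : ∀ i, Measurable (a i)) (hy : ∀ i, Measurable (y i))
    (hφ : ∀ t, Measurable (φ t)) (hκ : ∀ t, Measurable (κ t)) (t : Fin T) :
    beforeDraw a y φ κ t ≤ ‹MeasurableSpace Ω› := by
  refine Measurable.comap_le ?_
  fun_prop

omit [MeasurableSpace Ω] in
lemma measurable_beforeDraw (t : Fin T) :
    (∀ i, Measurable[beforeDraw a y φ κ t] (a i)) ∧
    (∀ i, Measurable[beforeDraw a y φ κ t] (y i)) ∧
    (∀ s < t, Measurable[beforeDraw a y φ κ t] (φ s)) ∧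
    (∀ s ≤ t, Measurable[beforeDraw a y φ κ t] (κ s)) := by
  have h : Measurable[beforeDraw a y φ κ t] (fun ω => ((fun i => a i ω, fun i => y i ω),
      (fun s : {s : Fin T // s < t} => φ s ω, fun s : {s : Fin T // s ≤ t} => κ s ω)) :
      Ω → ((Fin N → ℝ) × (Fin N → ℝ)) ×
        (({s : Fin T // s < t} → Fin N) × ({s : Fin T // s ≤ t} → Fin K))) :=
    comap_measurable _
  refine ⟨fun i => ?_, fun i => ?_, fun s hs => ?_, fun s hs => ?_⟩
  · exact (measurable_pi_apply i).comp (measurable_fst.comp (measurable_fst.comp h))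
  · exact (measurable_pi_apply i).comp (measurable_snd.comp (measurable_fst.comp h))
  · exact (measurable_pi_apply (⟨s, hs⟩ : {s : Fin T // s < t})).comp
      (measurable_fst.comp (measurable_snd.comp h))
  · exact (measurable_pi_apply (⟨s, hs⟩ : {s : Fin T // s ≤ t})).comp
      (measurable_snd.comp (measurable_snd.comp h))

open Classical in
/-- The arm pulled belongs to the interval selected. -/
lemma IsUCBFRun.ae_mem_remaining [IsProbabilityMeasure μ] (hrun : IsUCBFRun μ δ a y φ κ)
    (ha : ∀ i, Measurable (a i)) (hy : ∀ i, Measurable (y i)) (t : Fin T) :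
    ∀ᵐ ω ∂μ, Alive (fun j => a j ω) (fun s => φ s ω) t (κ t ω) →
      φ t ω ∈ remaining (fun j => a j ω) (fun s => φ s ω) t (κ t ω) := by
  have hm := beforeDraw_le ha hy hrun.measurable_arm hrun.measurable_interval t
  obtain ⟨fa, -, fφ, fκ⟩ := measurable_beforeDraw (a := a) (y := y) (φ := φ) (κ := κ) t
  have hms : ∀ i, MeasurableSet {ω' | φ t ω' = i} := fun i =>
    hrun.measurable_arm t (measurableSet_singleton i)
  have key : ∀ k i, μ {ω | (φ t ω = i) ∧ κ t ω = k ∧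
      Alive (fun j => a j ω) (fun s => φ s ω) t k ∧
      i ∉ remaining (fun j => a j ω) (fun s => φ s ω) t k} = 0 := by
    intro k i
    set B : Set Ω := {ω | κ t ω = k ∧ Alive (fun j => a j ω) (fun s => φ s ω) t k ∧
      i ∉ remaining (fun j => a j ω) (fun s => φ s ω) t k} with hB
    have hBm : MeasurableSet[beforeDraw a y φ κ t] B := by
      have h1 : MeasurableSet[beforeDraw a y φ κ t] {ω | κ t ω = k} :=
        fκ t le_rfl (measurableSet_singleton k)
      have h2 := measurableSet_alive fa t fφ k
      have h3 := measurableSet_rel (measurable_remaining fa t fφ k)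
        (measurable_remaining fa t fφ k) (fun R _ => i ∉ R)
      exact h1.inter (h2.inter h3)
    have h1 := setIntegral_condExp (μ := μ) hm
      ((integrable_const (1 : ℝ)).indicator (hms i)) hBm
    have h2 : ∫ ω in B, (μ[Set.indicator {ω' | φ t ω' = i} (fun _ => (1 : ℝ)) |
        beforeDraw a y φ κ t]) ω ∂μ = 0 := by
      rw [← integral_zero Ω ℝ (μ := μ.restrict B)]
      refine integral_congr_ae ?_
      rw [Filter.EventuallyEq, ae_restrict_iff' (hm _ hBm)]
      filter_upwards [hrun.draw t i] with ω hω hωB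
      obtain ⟨h3, h4, h5⟩ := hωB
      subst h3
      rw [hω h4, if_neg h5]
    rw [h2, setIntegral_indicator (hms i)] at h1
    simp only [integral_const, smul_eq_mul, mul_one, MeasurableSet.univ, measureReal_restrict_apply,
      Set.univ_inter] at h1
    have h3 : μ (B ∩ {ω' | φ t ω' = i}) = 0 := by
      rw [← measureReal_eq_zero_iff]
      exact h1.symm
    refine measure_mono_null ?_ h3
    rintro ω ⟨h4, h5⟩
    exact ⟨h5, h4⟩
  have hall : ∀ᵐ ω ∂μ, ∀ k i, ¬ ((φ t ω = i) ∧ κ t ω = k ∧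
      Alive (fun j => a j ω) (fun s => φ s ω) t k ∧
      i ∉ remaining (fun j => a j ω) (fun s => φ s ω) t k) := by
    rw [ae_all_iff]
    intro k
    rw [ae_all_iff]
    intro i
    rw [ae_iff]
    simpa using key k i
  filter_upwards [hall] with ω hω hal
  by_contra hn
  exact hω _ _ ⟨rfl, rfl, hal, hn⟩

/-- The active event is known before the draw. On it the drawn arm may be replaced by its uniform
law (`setIntegral_comp_draw`) and the one-step inequality used pointwise; off it nothing moves. -/
lemma integral_runPotential_succ_le [IsProbabilityMeasure μ] (hrun : IsUCBFRun μ δ a y φ κ)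
    (ha : ∀ i, Measurable (a i)) (hy : ∀ i, Measurable (y i)) {z : Fin N → Ω → ℝ}
    (hz01 : ∀ i ω, z i ω ∈ Set.Icc (0 : ℝ) 1)
    (hzm : ∀ t, ∀ i, Measurable[beforeDraw a y φ κ t] (z i))
    (k : Fin K) (s : ℝ) (n : ℕ) (t : Fin T) :
    ∫ ω, runPotential a z k s n (leftAfter a φ κ k n (t + 1) ω) ω ∂μ ≤
      ∫ ω, runPotential a z k s n (leftAfter a φ κ k n t ω) ω ∂μ := by
  classical
  have hm := beforeDraw_le ha hy hrun.measurable_arm hrun.measurable_interval t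
  obtain ⟨fa, -, fφ, fκ⟩ := measurable_beforeDraw (a := a) (y := y) (φ := φ) (κ := κ) t
  have hz : ∀ i, Measurable (z i) := fun i => (hzm t i).mono hm le_rfl
  have hleft : Measurable[beforeDraw a y φ κ t, ⊤] (leftAfter a φ κ k n t) :=
    measurable_leftAfter fa k n t t.2.le (fun s hs => fφ s hs) (fun s hs => fκ s hs.le)
  set E := activeEvent a φ κ k n t with hE
  have hEm : MeasurableSet[beforeDraw a y φ κ t] E :=
    measurableSet_activeEvent_of fa k n t fφ (fκ t le_rfl) hleft
  have hEm0 : MeasurableSet E := hm _ hEm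
  have hint : ∀ t' ≤ T, Integrable (fun ω =>
      runPotential a z k s n (leftAfter a φ κ k n t' ω) ω) μ := by
    intro t' ht'
    refine Integrable.of_bound (measurable_runPotential_comp ha hz k s n
      (measurable_leftAfter ha k n t' ht' (fun s _ => hrun.measurable_arm s)
        (fun s _ => hrun.measurable_interval s))).aestronglyMeasurable
      (Real.exp (|s| * N + N * s ^ 2 / 8)) (Filter.Eventually.of_forall fun ω => ?_)
    exact abs_runPotential_le hz01 k s n _ ω
  rw [← integral_add_compl hEm0 (hint _ t.2), ← integral_add_compl hEm0 (hint _ t.2.le)]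
  refine add_le_add ?_ (le_of_eq ?_)
  · have hG : ∀ i, Measurable[beforeDraw a y φ κ t] fun ω =>
        runPotential a z k s n ((leftAfter a φ κ k n t ω).erase i) ω := by
      intro i
      let _ : MeasurableSpace (Finset (Fin N)) := ⊤
      exact measurable_runPotential_comp fa (hzm t) k s n
        ((Measurable.of_discrete (f := fun R : Finset (Fin N) => R.erase i)).comp hleft)
    have hdraw := setIntegral_comp_draw hm (μ := μ) (hrun.measurable_arm t) hEm
      (q := fun i ω => if i ∈ leftAfter a φ κ k n t ω
        then (1 : ℝ) / (leftAfter a φ κ k n t ω).card else 0)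
      (fun i => by
        filter_upwards [hrun.draw t i] with ω hω hωE
        obtain ⟨h1, h2, -, h4⟩ := hωE
        replace h2 : κ t ω = k := h2
        have h5 := hω (by rw [h2]; exact h1)
        rw [h5, h2]
        -- This equality is part of `ActiveStep`, so the draw is uniform on the stopped set even
        -- without knowing that the run is typical.
        have h6 : leftAfter a φ κ k n t ω =
          remaining (fun i => a i ω) (fun s => φ s ω) t k := h4
        rw [h6])
      hG (fun i ω => abs_runPotential_le hz01 k s n _ ω)
    calc ∫ ω in E, runPotential a z k s n (leftAfter a φ κ k n (t + 1) ω) ω ∂μ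
        = ∫ ω in E, runPotential a z k s n ((leftAfter a φ κ k n t ω).erase (φ t ω)) ω ∂μ := by
          refine setIntegral_congr_fun hEm0 fun ω hω => ?_
          rw [leftAfter_succ, if_pos hω]
      _ = _ := hdraw.2
      _ ≤ ∫ ω in E, runPotential a z k s n (leftAfter a φ κ k n t ω) ω ∂μ := by
          refine setIntegral_mono_on hdraw.1 (hint _ t.2.le).integrableOn hEm0 fun ω hω => ?_
          exact sum_samplePotential_erase_le (fun i _ => hz01 i ω) hω.2.2.1
  · refine setIntegral_congr_fun hEm0.compl fun ω hω => ?_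
    rw [leftAfter_succ, if_neg hω]

lemma integral_runPotential_le_one [IsProbabilityMeasure μ] (hrun : IsUCBFRun μ δ a y φ κ)
    (ha : ∀ i, Measurable (a i)) (hy : ∀ i, Measurable (y i)) {z : Fin N → Ω → ℝ}
    (hz01 : ∀ i ω, z i ω ∈ Set.Icc (0 : ℝ) 1)
    (hzm : ∀ t, ∀ i, Measurable[beforeDraw a y φ κ t] (z i))
    (k : Fin K) (s : ℝ) (n : ℕ) (t : ℕ) (ht : t ≤ T) :
    ∫ ω, runPotential a z k s n (leftAfter a φ κ k n t ω) ω ∂μ ≤ 1 := by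
  induction t with
  | zero =>
    have : ∀ ω, runPotential a z k s n (leftAfter a φ κ k n 0 ω) ω = 1 := by
      intro ω
      have h0 : leftAfter a φ κ k n 0 ω = armsIn (fun i => a i ω) k := rfl
      rw [h0, runPotential, samplePotential]
      simp
    simp [this]
  | succ t ih =>
    exact (integral_runPotential_succ_le hrun ha hy hz01 hzm k s n ⟨t, ht⟩).trans (ih (by omega))

/-- The deviation, after `n` pulls in the `k`-th interval, of the total reward from `n` times the
average reward over the arms of this interval. -/
def pullDeviation (a z : Fin N → Ω → ℝ) (φ : Fin T → Ω → Fin N) (κ : Fin T → Ω → Fin K)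
    (k : Fin K) (n : ℕ) (ω : Ω) : ℝ :=
  (((armsIn (fun i => a i ω) k).card - n : ℕ) : ℝ) *
    ((∑ i ∈ armsIn (fun i => a i ω) k, z i ω) / (armsIn (fun i => a i ω) k).card
      - (∑ i ∈ leftAfter a φ κ k n T ω, z i ω) / (leftAfter a φ κ k n T ω).card)

/-- Markov's inequality for the potential; for `σ = 1`, `s = 4 * ε` maximises `s * n * ε - n * s ^ 2
/ 8`. The condition on the cardinality says that exactly `n` arms were withdrawn, and `σ = ±1`
covers both tails. -/
lemma measureReal_pullDeviation_ge_le [IsProbabilityMeasure μ] (hrun : IsUCBFRun μ δ a y φ κ)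
    (ha : ∀ i, Measurable (a i)) (hy : ∀ i, Measurable (y i)) {z : Fin N → Ω → ℝ}
    (hz01 : ∀ i ω, z i ω ∈ Set.Icc (0 : ℝ) 1)
    (hzm : ∀ t, ∀ i, Measurable[beforeDraw a y φ κ t] (z i)) (hz : ∀ i, Measurable (z i))
    (k : Fin K) (n : ℕ) {ε σ : ℝ} (hε : 0 ≤ ε) (hσ : σ ^ 2 = 1) :
    μ.real {ω | (leftAfter a φ κ k n T ω).card + n = (armsIn (fun i => a i ω) k).card ∧
      n * ε ≤ σ * pullDeviation a z φ κ k n ω} ≤ Real.exp (-(2 * n * ε ^ 2)) := by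
  set s := 4 * ε * σ with hs
  have hint : Integrable (fun ω =>
      runPotential a z k s n (leftAfter a φ κ k n T ω) ω) μ := by
    refine Integrable.of_bound (measurable_runPotential_comp ha hz k s n
      (measurable_leftAfter ha k n T le_rfl (fun s _ => hrun.measurable_arm s)
        (fun s _ => hrun.measurable_interval s))).aestronglyMeasurable
      (Real.exp (|s| * N + N * s ^ 2 / 8)) (Filter.Eventually.of_forall fun ω => ?_)
    exact abs_runPotential_le hz01 k s n _ ω
  have h1 := mul_meas_ge_le_integral_of_nonneg
    (Filter.Eventually.of_forall fun ω => (Real.exp_pos _).le) hint (Real.exp (2 * n * ε ^ 2))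
  have h2 := integral_runPotential_le_one hrun ha hy hz01 hzm k s n T le_rfl
  rw [Real.exp_neg, ← one_div, le_div_iff₀ (Real.exp_pos _), mul_comm]
  refine le_trans ?_ (h1.trans h2)
  refine mul_le_mul_of_nonneg_left (measureReal_mono ?_) (Real.exp_pos _).le
  · rintro ω ⟨hcard, hdev⟩
    have hc : (((leftAfter a φ κ k n T ω).card : ℝ)) + n = (armsIn (fun i => a i ω) k).card := by
      exact_mod_cast hcard
    change Real.exp (2 * n * ε ^ 2) ≤ Real.exp _
    rw [Real.exp_le_exp]
    have hs2 : s ^ 2 = 16 * ε ^ 2 := by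
      rw [hs]; calc _ = 16 * ε ^ 2 * σ ^ 2 := by ring
        _ = _ := by rw [hσ, mul_one]
    have h3 : s * pullDeviation a z φ κ k n ω = 4 * ε * (σ * pullDeviation a z φ κ k n ω) := by
      rw [hs]; ring
    have h4 : 4 * ε * (n * ε) ≤ s * pullDeviation a z φ κ k n ω := by
      rw [h3]; gcongr
    have h5 : ((armsIn (fun i => a i ω) k).card : ℝ) - (leftAfter a φ κ k n T ω).card = n := by
      linarith
    rw [h5, hs2, mul_assoc s]
    have h6 : 2 * n * ε ^ 2 = 4 * ε * (n * ε) - n * (16 * ε ^ 2) / 8 := by ring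
    rw [h6]
    exact sub_le_sub_right h4 _

end Supermartingale

/-! ### Deterministic properties of a run -/

section Path

variable {N T K : ℕ} {x z : Fin N → ℝ} {φ : Fin T → Fin N} {κ : Fin T → Fin K} {δ : ℝ}

lemma mem_armsIn {i : Fin N} {k : Fin K} : i ∈ armsIn x k ↔ x i ∈ cell K k := by
  simp [armsIn]

lemma mem_remaining {i : Fin N} {k : Fin K} {t : Fin T} :
    i ∈ remaining x φ t k ↔ x i ∈ cell K k ∧ ∀ s < t, φ s ≠ i := by
  simp [remaining]

lemma mem_pullTimes {s : Fin T} {k : Fin K} {t : Fin T} :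
    s ∈ pullTimes x φ t k ↔ s < t ∧ x (φ s) ∈ cell K k := by
  simp [pullTimes]

/-- The properties of a run at a typical outcome: no arm is pulled twice, an alive interval is
always selected according to the rule, and the arm pulled is a remaining arm of this interval. -/
structure IsTypicalRun (δ : ℝ) (x z : Fin N → ℝ) (φ : Fin T → Fin N) (κ : Fin T → Fin K) :
    Prop where
  inj : Function.Injective φ
  choice : ∀ t, IsChoice δ x z φ t (κ t)
  mem : ∀ t, φ t ∈ remaining x φ t (κ t)

/-- Pigeonhole: some arm is never pulled. This excludes the degenerate case in which the algorithm
is unspecified. -/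
lemma exists_alive_of_card_lt (hx : ∀ i, x i ∈ Set.Icc (0 : ℝ) 1) (hK : 0 < K)
    (htwo : ∀ k : Fin K, 2 ≤ (armsIn x k).card) (hTN : T < N) (t : Fin T) :
    ∃ k : Fin K, Alive x φ t k := by
  classical
  have h1 : ((Finset.univ : Finset (Fin T)).image φ).card < (Finset.univ : Finset (Fin N)).card := by
    refine lt_of_le_of_lt Finset.card_image_le ?_
    simpa using hTN
  obtain ⟨i, -, hi⟩ := Finset.exists_mem_notMem_of_card_lt_card h1
  obtain ⟨k, hk⟩ := exists_mem_cell hK (hx i)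
  refine ⟨k, htwo k, i, mem_remaining.2 ⟨hk, fun s _ hs => hi ?_⟩⟩
  exact Finset.mem_image.2 ⟨s, Finset.mem_univ _, hs⟩

namespace IsTypicalRun

variable (h : IsTypicalRun δ x z φ κ)
include h

lemma mem_cell (t : Fin T) : x (φ t) ∈ cell K (κ t) := (mem_remaining.1 (h.mem t)).1

lemma mem_cell_iff {t : Fin T} {k : Fin K} : x (φ t) ∈ cell K k ↔ κ t = k :=
  ⟨fun h' => cell_unique (h.mem_cell t) h', fun h' => h' ▸ h.mem_cell t⟩

omit h in
lemma disjoint_union (t : Fin T) (k : Fin K) :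
    Disjoint (remaining x φ t k) ((pullTimes x φ t k).image φ) ∧
      remaining x φ t k ∪ (pullTimes x φ t k).image φ = armsIn x k := by
  classical
  constructor
  · rw [Finset.disjoint_left]
    intro i hi hi'
    obtain ⟨s, hs, rfl⟩ := Finset.mem_image.1 hi'
    exact (mem_remaining.1 hi).2 s (mem_pullTimes.1 hs).1 rfl
  · ext i
    rw [Finset.mem_union, mem_remaining, mem_armsIn, Finset.mem_image]
    constructor
    · rintro (h1 | ⟨s, hs, rfl⟩)
      · exact h1.1
      · exact (mem_pullTimes.1 hs).2
    · intro hi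
      by_cases hp : ∃ s < t, φ s = i
      · obtain ⟨s, hs, rfl⟩ := hp
        exact Or.inr ⟨s, mem_pullTimes.2 ⟨hs, hi⟩, rfl⟩
      · push Not at hp
        exact Or.inl ⟨hi, hp⟩

lemma card_add (t : Fin T) (k : Fin K) :
    (remaining x φ t k).card + (pullTimes x φ t k).card = (armsIn x k).card := by
  classical
  obtain ⟨h1, h2⟩ := disjoint_union (x := x) (φ := φ) t k
  rw [← h2, Finset.card_union_of_disjoint h1, Finset.card_image_of_injective _ h.inj]

lemma sum_add (t : Fin T) (k : Fin K) :
    ∑ i ∈ remaining x φ t k, z i + ∑ s ∈ pullTimes x φ t k, z (φ s) = ∑ i ∈ armsIn x k, z i := by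
  classical
  obtain ⟨h1, h2⟩ := disjoint_union (x := x) (φ := φ) t k
  rw [← h2, Finset.sum_union h1, Finset.sum_image fun _ _ _ _ e => h.inj e]

/-- Freezing has no effect while at least `g` arms remain, and since the remaining sets shrink this
condition passes to earlier steps. -/
lemma stoppedLeft_eq_remaining (k : Fin K) (g : ℕ) (t : ℕ) (ht : t < T)
    (hg : g ≤ (remaining x φ ⟨t, ht⟩ k).card) :
    stoppedLeft x φ κ k g t = remaining x φ ⟨t, ht⟩ k := by
  classical
  induction t with
  | zero =>
    ext i
    rw [stoppedLeft, mem_armsIn, mem_remaining]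
    simp only [iff_self_and]
    intro _ s hs
    exact absurd hs (Nat.not_lt_zero _)
  | succ t ih =>
    have ht' : t < T := by omega
    set t₀ : Fin T := ⟨t, ht'⟩ with ht₀
    by_cases hk : κ t₀ = k
    · have hmem : φ t₀ ∈ remaining x φ t₀ k := hk ▸ h.mem t₀
      have herase : remaining x φ ⟨t + 1, ht⟩ k = (remaining x φ t₀ k).erase (φ t₀) := by
        ext i
        rw [mem_remaining, Finset.mem_erase, mem_remaining]
        constructor
        · rintro ⟨h1, h2⟩
          exact ⟨fun e => h2 t₀ (Nat.lt_succ_self t) e.symm, h1,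
            fun s hs => h2 s (lt_trans hs (Nat.lt_succ_self t))⟩
        · rintro ⟨h1, h2, h3⟩
          refine ⟨h2, fun s hs => ?_⟩
          rcases lt_or_eq_of_le (Nat.le_of_lt_succ hs) with h4 | h4
          · exact h3 s h4
          · have : s = t₀ := Fin.ext h4
            rw [this]
            exact fun e => h1 e.symm
      rw [herase, Finset.card_erase_of_mem hmem] at hg
      have hpos := Finset.card_pos.2 ⟨_, hmem⟩
      have ih' : stoppedLeft x φ κ k g t = remaining x φ t₀ k := ih ht' (hg.trans (Nat.sub_le _ _))
      have hact : ActiveStep x φ κ k g t₀ := by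
        refine ⟨hk ▸ (h.choice t₀).1, hk, ?_, ih'⟩
        change g < (stoppedLeft x φ κ k g t).card
        rw [ih']
        omega
      rw [stoppedLeft_succ_of_active (t := t₀) hact, herase]
      exact congrArg (fun R => Finset.erase R (φ t₀)) ih'
    · have hsame : remaining x φ ⟨t + 1, ht⟩ k = remaining x φ t₀ k := by
        ext i
        rw [mem_remaining, mem_remaining]
        constructor
        · rintro ⟨h1, h2⟩
          exact ⟨h1, fun s hs => h2 s (lt_trans hs (Nat.lt_succ_self t))⟩
        · rintro ⟨h1, h2⟩
          refine ⟨h1, fun s hs => ?_⟩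
          rcases lt_or_eq_of_le (Nat.le_of_lt_succ hs) with h4 | h4
          · exact h2 s h4
          · have : s = t₀ := Fin.ext h4
            rw [this]
            rintro rfl
            exact hk (h.mem_cell_iff.1 h1)
      rw [hsame] at hg ⊢
      rw [stoppedLeft_succ_of_not_active (t := t₀) (fun hact => hk hact.2.1)]
      exact ih ht' hg

/-- Freezing at the size reached at step `t` preserves that set until the end. A deviation at an
arbitrary step thus becomes one indexed by the number of pulls alone, ready for a union bound. -/
lemma stoppedLeft_end (k : Fin K) (t : Fin T) :
    stoppedLeft x φ κ k (remaining x φ t k).card T = remaining x φ t k := by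
  set g := (remaining x φ t k).card with hg
  have key : ∀ r, (t : ℕ) + r ≤ T → stoppedLeft x φ κ k g (t + r) = remaining x φ t k := by
    intro r
    induction r with
    | zero => exact fun _ => h.stoppedLeft_eq_remaining k g t t.2 le_rfl
    | succ r ih =>
      intro hr
      have ih' := ih (by omega)
      have hlt : (t : ℕ) + r < T := by omega
      rw [← add_assoc]
      rw [stoppedLeft_succ_of_not_active (t := ⟨t + r, hlt⟩), ih']
      intro hact
      have h1 := hact.2.2.1
      simp only [ih'] at h1
      omega
  have := key (T - t) (by omega)
  rwa [Nat.add_sub_cancel' t.2.le] at this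

/-- The deviation of the average reward observed in an interval, in terms of the arms left. -/
lemma abs_empMean_sub_le (k : Fin K) (t : Fin T) (hne : (pullTimes x φ t k).Nonempty) {ε : ℝ}
    (hdev : |(((armsIn x k).card - (pullTimes x φ t k).card : ℕ) : ℝ) *
      ((∑ i ∈ armsIn x k, z i) / (armsIn x k).card
        - (∑ i ∈ stoppedLeft x φ κ k ((armsIn x k).card - (pullTimes x φ t k).card) T, z i) /
          (stoppedLeft x φ κ k ((armsIn x k).card - (pullTimes x φ t k).card) T).card)| ≤
      (pullTimes x φ t k).card * ε) :
    |empMean x z φ t k - (∑ i ∈ armsIn x k, z i) / (armsIn x k).card| ≤ ε := by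
  have hc := h.card_add t k
  have hs := h.sum_add t k
  have hg : (armsIn x k).card - (pullTimes x φ t k).card = (remaining x φ t k).card := by omega
  rw [hg, h.stoppedLeft_end k t] at hdev
  have hn : (0 : ℝ) < (pullTimes x φ t k).card := by exact_mod_cast hne.card_pos
  have hcR : ((remaining x φ t k).card : ℝ) + (pullTimes x φ t k).card = (armsIn x k).card := by
    exact_mod_cast hc
  set R := remaining x φ t k
  set P := pullTimes x φ t k
  set A := armsIn x k
  have hR : (R.card : ℝ) * ((∑ i ∈ R, z i) / R.card) = ∑ i ∈ R, z i := by
    rcases R.eq_empty_or_nonempty with h0 | h0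
    · simp [h0]
    · have : (0 : ℝ) < R.card := by exact_mod_cast h0.card_pos
      field_simp
  have hA : (A.card : ℝ) * ((∑ i ∈ A, z i) / A.card) = ∑ i ∈ A, z i := by
    have : (0 : ℝ) < A.card := by
      have : (0 : ℝ) ≤ R.card := by positivity
      linarith
    field_simp
  -- The excess of the pulled arms over the overall average is the deficit of the arms left.
  have key : (P.card : ℝ) * (empMean x z φ t k - (∑ i ∈ A, z i) / A.card) =
      (R.card : ℝ) * ((∑ i ∈ A, z i) / A.card - (∑ i ∈ R, z i) / R.card) := by
    have : (P.card : ℝ) * empMean x z φ t k = ∑ s ∈ P, z (φ s) := by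
      rw [empMean]
      exact mul_div_cancel₀ _ hn.ne'
    rw [mul_sub, mul_sub, this, hR]
    rw [← hcR, add_mul] at hA
    rw [hcR] at hA
    linarith
  rw [← key, abs_mul, abs_of_pos hn] at hdev
  exact le_of_mul_le_mul_left hdev hn

end IsTypicalRun

end Path

/-! ### Sums of inverse gaps -/

/-- Sorted increasingly, the value of rank `r + 1` is at least `(r + 1) / B`. The induction removes
the largest element. -/
lemma sum_inv_pow_le {ι : Type*} (J : Finset ι) (d : ι → ℝ) (hd : ∀ j ∈ J, 0 < d j) {B : ℝ}
    (hB : ∀ j ∈ J, ((J.filter fun i => d i ≤ d j).card : ℝ) ≤ B * d j) (e : ℕ) :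
    ∑ j ∈ J, (1 / d j) ^ e ≤ ∑ r ∈ Finset.range J.card, (B / ((r : ℝ) + 1)) ^ e := by
  classical
  induction J using Finset.induction_on_max_value d with
  | empty => simp
  | insert a s ha hmax ih =>
    rw [Finset.sum_insert ha, Finset.card_insert_of_notMem ha, Finset.sum_range_succ, add_comm]
    have hda := hd a (Finset.mem_insert_self a s)
    refine add_le_add (ih (fun j hj => hd j (Finset.mem_insert_of_mem hj)) fun j hj => ?_) ?_
    · refine le_trans ?_ (hB j (Finset.mem_insert_of_mem hj))
      exact_mod_cast Finset.card_le_card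
        (Finset.filter_subset_filter _ (Finset.subset_insert a s))
    · have h1 := hB a (Finset.mem_insert_self a s)
      have h2 : (insert a s).filter (fun i => d i ≤ d a) = insert a s := by
        rw [Finset.filter_eq_self]
        intro i hi
        rcases Finset.mem_insert.1 hi with rfl | hi
        · exact le_rfl
        · exact hmax i hi
      rw [h2, Finset.card_insert_of_notMem ha] at h1
      push_cast at h1
      refine pow_le_pow_left₀ (one_div_nonneg.2 hda.le) ?_ e
      rw [div_le_div_iff₀ hda (by positivity)]
      linarith

lemma sum_range_inv_sq_le (n : ℕ) : ∑ r ∈ Finset.range n, (1 / ((r : ℝ) + 1)) ^ 2 ≤ 2 := by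
  have h : ∀ n : ℕ, ∑ r ∈ Finset.range (n + 1), (1 / ((r : ℝ) + 1)) ^ 2 ≤ 2 - 1 / ((n : ℝ) + 1) := by
    intro n
    induction n with
    | zero => norm_num
    | succ n ih =>
      rw [Finset.sum_range_succ]
      have : (1 / (((n + 1 : ℕ) : ℝ) + 1)) ^ 2 ≤
          1 / ((n : ℝ) + 1) - 1 / (((n + 1 : ℕ) : ℝ) + 1) := by
        push_cast
        rw [div_pow, one_pow, div_sub_div _ _ (by positivity) (by positivity),
          div_le_div_iff₀ (by positivity) (by positivity)]
        have : (0 : ℝ) ≤ n := by positivity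
        nlinarith
      linarith
  rcases n with _ | n
  · simp
  · refine (h n).trans ?_
    have : (0 : ℝ) ≤ 1 / ((n : ℝ) + 1) := by positivity
    linarith

lemma sum_range_inv_le (n : ℕ) :
    ∑ r ∈ Finset.range n, (1 / ((r : ℝ) + 1)) ≤ 1 + Real.log n := by
  have h := harmonic_le_one_add_log n
  refine le_trans (le_of_eq ?_) h
  rw [harmonic]
  push_cast
  exact Finset.sum_congr rfl fun r _ => by rw [one_div]

lemma sum_inv_le {ι : Type*} (J : Finset ι) (d : ι → ℝ) (hd : ∀ j ∈ J, 0 < d j) {B : ℝ}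
    (hB0 : 0 ≤ B) (hB : ∀ j ∈ J, ((J.filter fun i => d i ≤ d j).card : ℝ) ≤ B * d j) :
    ∑ j ∈ J, 1 / d j ≤ B * (1 + Real.log J.card) := by
  have h := sum_inv_pow_le J d hd hB 1
  simp only [pow_one] at h
  refine h.trans ?_
  rw [show ∑ r ∈ Finset.range J.card, B / ((r : ℝ) + 1) =
    B * ∑ r ∈ Finset.range J.card, (1 / ((r : ℝ) + 1)) by
      rw [Finset.mul_sum]; exact Finset.sum_congr rfl fun r _ => by ring]
  exact mul_le_mul_of_nonneg_left (sum_range_inv_le _) hB0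

lemma sum_inv_sq_le {ι : Type*} (J : Finset ι) (d : ι → ℝ) (hd : ∀ j ∈ J, 0 < d j) {B : ℝ}
    (hB : ∀ j ∈ J, ((J.filter fun i => d i ≤ d j).card : ℝ) ≤ B * d j) :
    ∑ j ∈ J, (1 / d j) ^ 2 ≤ 2 * B ^ 2 := by
  refine (sum_inv_pow_le J d hd hB 2).trans ?_
  rw [show ∑ r ∈ Finset.range J.card, (B / ((r : ℝ) + 1)) ^ 2 =
    B ^ 2 * ∑ r ∈ Finset.range J.card, (1 / ((r : ℝ) + 1)) ^ 2 by
      rw [Finset.mul_sum]; exact Finset.sum_congr rfl fun r _ => by ring]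
  nlinarith [sum_range_inv_sq_le J.card, sq_nonneg B]

/-! ### The regret of a typical run -/

section Regret

variable {N T K : ℕ} {x z : Fin N → ℝ} {φ : Fin T → Fin N} {κ : Fin T → Fin K} {δ : ℝ}
  {m : ℝ → ℝ} {M L Q : ℝ}

open Classical in
/-- The loss, with respect to a level `M`, incurred on a set `A` of arms when the arms of `P` are
pulled. -/
def levelLoss (m : ℝ → ℝ) (M : ℝ) (x : Fin N → ℝ) (P A : Finset (Fin N)) : ℝ :=
  ∑ i ∈ A, if i ∈ P then max (M - m (x i)) 0 else max (m (x i) - M) 0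

open Classical in
-- Both strategies pull `T` arms, so `M` can be subtracted from every mean. The oracle then gains at
-- most the sum of all positive parts.
lemma regret_le_levelLoss (hφ : Function.Injective φ) (M : ℝ) :
    regret m x φ ≤ levelLoss m M x (Finset.univ.image φ) Finset.univ := by
  have hTN : T ≤ N := by simpa using Fintype.card_le_of_injective φ hφ
  set u : Fin N → ℝ := fun i => m (x i) - M with hu
  have hcard : ((Finset.univ : Finset (Fin N)).filter (fun t : Fin N => (t : ℕ) < T)).card = T := by
    rw [Fin.card_filter_val_lt, min_eq_right hTN]
  have h1 : regret m x φ = ∑ t ∈ (Finset.univ : Finset (Fin N)).filter (fun t : Fin N => (t : ℕ) < T),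
      u (Tuple.sort (fun i => - m (x i)) t) - ∑ t : Fin T, u (φ t) := by
    rw [regret, hu]
    simp only [Finset.sum_sub_distrib, Finset.sum_const, hcard, Finset.card_univ, Fintype.card_fin]
    ring
  have h2 : ∑ t ∈ (Finset.univ : Finset (Fin N)).filter (fun t : Fin N => (t : ℕ) < T),
      u (Tuple.sort (fun i => - m (x i)) t) ≤ ∑ i, max (u i) 0 := by
    rw [← Equiv.sum_comp (Tuple.sort (fun i => - m (x i))) (fun i => max (u i) 0)]
    calc _ ≤ ∑ t ∈ (Finset.univ : Finset (Fin N)).filter (fun t : Fin N => (t : ℕ) < T),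
          max (u (Tuple.sort (fun i => - m (x i)) t)) 0 :=
          Finset.sum_le_sum fun i _ => le_max_left _ _
      _ ≤ _ := Finset.sum_le_sum_of_subset_of_nonneg (Finset.filter_subset _ _)
          fun i _ _ => le_max_right _ _
  have h3 : ∑ t : Fin T, u (φ t) = ∑ i, if i ∈ Finset.univ.image φ then u i else 0 := by
    rw [← Finset.sum_filter, Finset.filter_univ_mem,
      Finset.sum_image fun _ _ _ _ e => hφ e]
  rw [h1, h3, levelLoss]
  have h4 : ∀ i, (if i ∈ Finset.univ.image φ then max (M - m (x i)) 0 else max (m (x i) - M) 0) =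
      max (u i) 0 - if i ∈ Finset.univ.image φ then u i else 0 := by
    intro i
    split_ifs
    · have : M - m (x i) = -u i := by rw [hu]; ring
      rw [this]
      rcases le_total (u i) 0 with h | h
      · rw [max_eq_left (by linarith), max_eq_right h]; ring
      · rw [max_eq_right (by linarith), max_eq_left h]; ring
    · rw [sub_zero]
  rw [Finset.sum_congr rfl fun i _ => h4 i, Finset.sum_sub_distrib (f := fun i => max (u i) 0)]
  exact sub_le_sub_right h2 _

lemma sum_armsIn {f : Fin N → ℝ} (hx : ∀ i, x i ∈ Set.Icc (0 : ℝ) 1) (hK : 0 < K) :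
    ∑ k : Fin K, ∑ i ∈ armsIn x k, f i = ∑ i, f i := by
  classical
  rw [← Finset.sum_biUnion]
  · refine Finset.sum_congr ?_ fun _ _ => rfl
    ext i
    simp only [Finset.mem_biUnion, Finset.mem_univ, true_and, iff_true, mem_armsIn]
    exact exists_mem_cell hK (hx i)
  · intro i _ j _ hij
    rw [Function.onFun, Finset.disjoint_left]
    intro a hi hj
    exact hij (cell_unique (mem_armsIn.1 hi) (mem_armsIn.1 hj))

/-- The mean reward, averaged over the arms of the `k`-th interval. -/
def cellMean (m : ℝ → ℝ) (x : Fin N → ℝ) (k : Fin K) : ℝ :=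
  (∑ i ∈ armsIn x k, m (x i)) / (armsIn x k).card

lemma le_cellMean {k : Fin K} (hne : (armsIn x k).Nonempty) {c : ℝ}
    (h : ∀ v ∈ cell K k, c ≤ m v) : c ≤ cellMean m x k := by
  rw [cellMean, le_div_iff₀ (by exact_mod_cast hne.card_pos), mul_comm, ← nsmul_eq_mul]
  exact Finset.card_nsmul_le_sum _ _ _ fun i hi => h _ (mem_armsIn.1 hi)

lemma cellMean_le {k : Fin K} (hne : (armsIn x k).Nonempty) {c : ℝ}
    (h : ∀ v ∈ cell K k, m v ≤ c) : cellMean m x k ≤ c := by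
  rw [cellMean, div_le_iff₀ (by exact_mod_cast hne.card_pos), mul_comm, ← nsmul_eq_mul]
  exact Finset.sum_le_card_nsmul _ _ _ fun i hi => h _ (mem_armsIn.1 hi)

open Classical in
/-- The steps at which an arm of the `k`-th interval is pulled. -/
def allPulls (x : Fin N → ℝ) (φ : Fin T → Fin N) (k : Fin K) : Finset (Fin T) :=
  {s | x (φ s) ∈ cell K k}

lemma mem_allPulls {s : Fin T} {k : Fin K} : s ∈ allPulls x φ k ↔ x (φ s) ∈ cell K k := by
  simp [allPulls]

lemma sum_card_allPulls (hx : ∀ i, x i ∈ Set.Icc (0 : ℝ) 1) (hK : 0 < K) :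
    ∑ k : Fin K, (allPulls x φ k).card = T := by
  classical
  rw [← Finset.card_biUnion]
  · have : Finset.univ.biUnion (fun k : Fin K => allPulls x φ k) = Finset.univ := by
      ext t
      simp only [Finset.mem_biUnion, Finset.mem_univ, true_and, iff_true, mem_allPulls]
      exact exists_mem_cell hK (hx _)
    rw [this, Finset.card_univ, Fintype.card_fin]
  · intro i _ j _ hij
    rw [Function.onFun, Finset.disjoint_left]
    intro a hi hj
    exact hij (cell_unique (mem_allPulls.1 hi) (mem_allPulls.1 hj))

lemma card_allPulls_le (hφ : Function.Injective φ) (k : Fin K) :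
    (allPulls x φ k).card ≤ (armsIn x k).card := by
  classical
  rw [← Finset.card_image_of_injective _ hφ]
  refine Finset.card_le_card fun i hi => ?_
  obtain ⟨s, hs, rfl⟩ := Finset.mem_image.1 hi
  exact mem_armsIn.2 (mem_allPulls.1 hs)

/-- A typical run in which moreover all the empirical means and the numbers of arms are close to
what is expected. -/
structure IsGoodRun (m : ℝ → ℝ) (M L δ : ℝ) (x z : Fin N → ℝ) (φ : Fin T → Fin N)
    (κ : Fin T → Fin K) : Prop where
  typical : IsTypicalRun δ x z φ κ
  mem_Icc : ∀ i, x i ∈ Set.Icc (0 : ℝ) 1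
  two_le : ∀ k : Fin K, 2 ≤ (armsIn x k).card
  card_le : ∀ k : Fin K, ((armsIn x k).card : ℝ) ≤ 2 * N / K
  card_above : (T : ℝ) + 3 * N / (4 * K) ≤ ∑ k ∈ cellsAbove m M L K, ((armsIn x k).card : ℝ)
  card_below : (N : ℝ) - T + 3 * N / (4 * K) ≤
    ∑ k ∈ cellsAbove (fun v => - m v) (-M) L K, ((armsIn x k).card : ℝ)
  confidence : ∀ (t : Fin T) (k : Fin K), (pullTimes x φ t k).Nonempty →
    |empMean x z φ t k - cellMean m x k| ≤
      Real.sqrt (Real.log (T / δ) / (2 * (pullTimes x φ t k).card)) + 1 / K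

namespace IsGoodRun

variable (h : IsGoodRun m M L δ x z φ κ)
include h

lemma armsIn_nonempty (k : Fin K) : (armsIn x k).Nonempty :=
  Finset.card_pos.1 (lt_of_lt_of_le (by norm_num) (h.two_le k))

/-- An interval is not pulled often if it is clearly worse than intervals which stay alive. -/
lemma card_allPulls_le_of_gap (hlog : 0 ≤ Real.log (T / δ)) {k : Fin K} {D : ℝ} (hD : 0 < D)
    (hgap : ∀ t : Fin T, ∃ j : Fin K, Alive x φ t j ∧ D ≤ cellMean m x j - cellMean m x k - 2 / K) :
    ((allPulls x φ k).card : ℝ) ≤ 2 * Real.log (T / δ) / D ^ 2 + 1 := by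
  classical
  set ℓ := Real.log (T / δ) with hℓ
  rcases (allPulls x φ k).eq_empty_or_nonempty with h0 | h0
  · rw [h0]
    simp only [Finset.card_empty, Nat.cast_zero]
    positivity
  -- At the last pull of the cell, all its other pulls are in the past; the last one is the `+ 1` of
  -- the bound.
  set t := (allPulls x φ k).max' h0 with ht
  have htmem : t ∈ allPulls x φ k := Finset.max'_mem _ h0
  have hpull : pullTimes x φ t k = (allPulls x φ k).erase t := by
    ext s
    rw [mem_pullTimes, Finset.mem_erase, mem_allPulls]
    constructor
    · rintro ⟨h1, h2⟩
      exact ⟨h1.ne, h2⟩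
    · rintro ⟨h1, h2⟩
      exact ⟨lt_of_le_of_ne (Finset.le_max' _ _ (mem_allPulls.2 h2)) h1, h2⟩
  have hcard : (allPulls x φ k).card = (pullTimes x φ t k).card + 1 := by
    rw [hpull, Finset.card_erase_add_one htmem]
  rw [hcard]
  push_cast
  gcongr
  rcases (pullTimes x φ t k).eq_empty_or_nonempty with h1 | h1
  · rw [h1]
    simp only [Finset.card_empty, Nat.cast_zero]
    positivity
  have hn : (0 : ℝ) < (pullTimes x φ t k).card := by exact_mod_cast h1.card_pos
  have hκ : κ t = k := h.typical.mem_cell_iff.1 (mem_allPulls.1 htmem)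
  obtain ⟨j, hj, hDj⟩ := hgap t
  have hch := h.typical.choice t
  rw [hκ] at hch
  -- As the cell was pulled before, initialisation is over: `j` has been sampled and its confidence
  -- bound is available.
  have hmax := (hch.2.resolve_left h1.ne_empty) j hj
  have hcj := abs_le.1 (h.confidence t j hmax.1)
  have hck := abs_le.1 (h.confidence t k h1)
  have hu := hmax.2
  unfold ucb at hu
  rw [← hℓ] at hcj hck hu
  set β := Real.sqrt (ℓ / (2 * (pullTimes x φ t k).card)) with hβ
  have e : (2 : ℝ) / K = 1 / K + 1 / K := by ring
  rw [e] at hDj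
  have h2 : D ≤ 2 * β := by linarith [hcj.1, hck.2]
  have h3 : D ^ 2 ≤ (2 * β) ^ 2 := by gcongr
  have h4 : β ^ 2 = ℓ / (2 * (pullTimes x φ t k).card) := Real.sq_sqrt (by positivity)
  rw [mul_pow, h4] at h3
  rw [le_div_iff₀ (by positivity)]
  have h5 : (2 : ℝ) ^ 2 * (ℓ / (2 * (pullTimes x φ t k).card)) * (pullTimes x φ t k).card =
      2 * ℓ := by
    field_simp
  nlinarith [mul_le_mul_of_nonneg_right h3 hn.le]

/-- If these cells were all dead, all their arms would have been pulled, but they contain more than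
`T` arms. -/
lemma exists_alive_above (hN : 0 < N) (t : Fin T) :
    ∃ j ∈ cellsAbove m M L K, Alive x φ t j := by
  classical
  by_contra! hcon
  have hK : (0 : ℝ) < K := by exact_mod_cast (κ t).pos
  have hN' : (0 : ℝ) < N := by exact_mod_cast hN
  have h1 : ∀ j ∈ cellsAbove m M L K, (armsIn x j).card ≤ (allPulls x φ j).card := by
    intro j hj
    have h2 : ¬ (remaining x φ t j).Nonempty := fun h2 => hcon j hj ⟨h.two_le j, h2⟩
    have h3 := h.typical.card_add t j
    rw [Finset.not_nonempty_iff_eq_empty.1 h2, Finset.card_empty, zero_add] at h3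
    rw [← h3]
    exact Finset.card_le_card fun s hs => mem_allPulls.2 (mem_pullTimes.1 hs).2
  have h2 : ∑ j ∈ cellsAbove m M L K, (armsIn x j).card ≤ T := by
    rw [← sum_card_allPulls (φ := φ) h.mem_Icc (κ t).pos]
    exact (Finset.sum_le_sum h1).trans
      (Finset.sum_le_sum_of_subset (Finset.subset_univ _))
  have h3 := h.card_above
  have h4 : ∑ k ∈ cellsAbove m M L K, ((armsIn x k).card : ℝ) ≤ T := by exact_mod_cast h2
  have : 0 < 3 * (N : ℝ) / (4 * K) := by positivity
  linarith

end IsGoodRun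

/-- A cell whose left end point has a gap larger than `c / K`. -/
def IsFar (m : ℝ → ℝ) (M c : ℝ) (K : ℕ) (k : Fin K) : Prop := c / K < cellGap m M K k

lemma gap_le_of_not_isFar (hL : 0 ≤ L) (hLip : WeaklyLipschitz m M L) {c : ℝ} (hc : L ≤ c)
    {k : Fin K} (hk : ¬ IsFar m M c K k) {v : ℝ} (hv : v ∈ cell K k) :
    |m v - M| ≤ 2 * c / K := by
  have h1 := hLip.gap_le hL (cell_subset_unitInterval (left_mem_cell (k := k)))
    (cell_subset_unitInterval hv) (dist_le_of_mem_cell left_mem_cell hv)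
  rw [IsFar, not_lt, cellGap] at hk
  have h2 : L * (1 / K) ≤ c / K := by rw [mul_one_div]; gcongr
  have h3 : max |m ((k : ℝ) / K) - M| (L * (1 / K)) ≤ c / K := max_le hk h2
  have : 2 * c / K = c / K + c / K := by ring
  linarith

/-- All the points of a far cell lie on the same side of the level, at comparable gaps. -/
lemma IsFar.side (hL : 0 ≤ L) (hLip : WeaklyLipschitz m M L) {c : ℝ} (hc : 2 * L ≤ c)
    {k : Fin K} (hk : IsFar m M c K k) :
    (∀ v ∈ cell K k, cellGap m M K k / 2 ≤ m v - M ∧ m v - M ≤ 2 * cellGap m M K k) ∨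
    (∀ v ∈ cell K k, cellGap m M K k / 2 ≤ M - m v ∧ M - m v ≤ 2 * cellGap m M K k) := by
  have h2 : 2 * (L * (1 / K)) ≤ c / K := by
    rw [mul_one_div, ← mul_div_assoc]; gcongr
  have hk' : c / K < |m ((k : ℝ) / K) - M| := hk
  rcases le_or_gt 0 (m ((k : ℝ) / K) - M) with h0 | h0
  · left
    intro v hv
    rw [cellGap]
    rw [abs_of_nonneg h0] at hk' ⊢
    have := hLip.far_of_pos hL (cell_subset_unitInterval (left_mem_cell (k := k)))
      (cell_subset_unitInterval hv) (dist_le_of_mem_cell left_mem_cell hv) (by linarith)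
    constructor <;> linarith [this.1, this.2]
  · right
    intro v hv
    rw [cellGap]
    rw [abs_of_neg h0] at hk' ⊢
    have := hLip.far_of_neg hL (cell_subset_unitInterval (left_mem_cell (k := k)))
      (cell_subset_unitInterval hv) (dist_le_of_mem_cell left_mem_cell hv) (by linarith)
    constructor <;> linarith [this.1, this.2]

namespace IsGoodRun

variable (h : IsGoodRun m M L δ x z φ κ)
include h

/-- The competitor has mean at least `M - 2 * L / K`, and this cell at most `M` minus half its gap.
By the choice of `c`, the errors `2 * L / K + 2 / K` use at most another quarter of the gap. -/
lemma card_allPulls_le_of_far (hlog : 0 ≤ Real.log (T / δ)) (hN : 0 < N) {c : ℝ}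
    (hL : 0 ≤ L) (hc : 8 * (L + 1) ≤ c) {k : Fin K} (hk : IsFar m M c K k)
    (hbelow : ∀ v ∈ cell K k, cellGap m M K k / 2 ≤ M - m v) :
    ((allPulls x φ k).card : ℝ) ≤ 32 * Real.log (T / δ) * (1 / cellGap m M K k) ^ 2 + 1 := by
  have hK : (0 : ℝ) < K := by exact_mod_cast k.pos
  have hk' : c / K < cellGap m M K k := hk
  have hcK : 8 * (L + 1) / K ≤ c / K := by gcongr
  have hc0 : 0 < c := by linarith
  have hd : 0 < cellGap m M K k := lt_of_le_of_lt (by positivity) hk'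
  have h1 := h.card_allPulls_le_of_gap hlog (k := k) (D := cellGap m M K k / 4) (by positivity) ?_
  · refine h1.trans (le_of_eq ?_)
    field_simp
    ring
  · intro t
    obtain ⟨j, hj, hja⟩ := h.exists_alive_above hN t
    refine ⟨j, hja, ?_⟩
    have h2 := le_cellMean (m := m) (h.armsIn_nonempty j) (mem_cellsAbove.1 hj)
    have h3 := cellMean_le (m := m) (h.armsIn_nonempty k) (c := M - cellGap m M K k / 2) fun v hv => by
      linarith [hbelow v hv]
    have e : 8 * (L + 1) / K = 4 * (2 * L / K + 2 / K) := by ring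
    linarith

/-- Here the competitor is a far cell above the level that never dies. It beats even cells slightly
above `M`, by a margin of order `c / K`. -/
lemma card_allPulls_le_of_near (hlog : 0 ≤ Real.log (T / δ)) {c : ℝ}
    (hL : 0 ≤ L) (hc : 8 * (L + 1) ≤ c) {k j : Fin K}
    (hk : k ∈ cellsAbove (fun v => - m v) (-M) L K)
    (hj : ∀ v ∈ cell K j, c / K / 2 ≤ m v - M) (halive : ∀ t, Alive x φ t j) :
    ((allPulls x φ k).card : ℝ) ≤ 32 * Real.log (T / δ) * K ^ 2 / c ^ 2 + 1 := by
  have hK : (0 : ℝ) < K := by exact_mod_cast k.pos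
  have hc0 : 0 < c := by linarith
  have h1 := h.card_allPulls_le_of_gap hlog (k := k) (D := c / K / 4) (by positivity) ?_
  · refine h1.trans (le_of_eq ?_)
    field_simp
    ring
  · intro t
    refine ⟨j, halive t, ?_⟩
    have h2 := le_cellMean (m := m) (h.armsIn_nonempty j) (c := M + c / K / 2) fun v hv => by
      linarith [hj v hv]
    have h3 := cellMean_le (m := m) (h.armsIn_nonempty k) (c := M + 2 * L / K) fun v hv => by
      have := mem_cellsAbove.1 hk v hv
      linarith
    have hcK : 8 * (L + 1) / K ≤ c / K := by gcongr
    have e : 8 * (L + 1) / K = 4 * (2 * L / K + 2 / K) := by ring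
    linarith

open Classical in
/-- The far cells above the level are exhausted by a good run. -/
lemma exhausted_of_far (hlog : 0 ≤ Real.log (T / δ)) (hN : 0 < N) {c : ℝ} (hL : 0 ≤ L)
    (hc : 8 * (L + 1) ≤ c) (hQ : 0 ≤ Q) (hLip : WeaklyLipschitz m M L)
    (hmargin : MarginCondition m M Q)
    (hbig : 264 * (Q + 1) ^ 2 * Real.log (T / δ) * K ^ 2 + K < 3 * N / (4 * K)) {j : Fin K}
    (hj : ∀ v ∈ cell K j, c / K / 2 ≤ m v - M) {i : Fin N} (hi : x i ∈ cell K j) :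
    i ∈ Finset.univ.image φ := by
  by_contra hnot
  have hKpos : 0 < K := j.pos
  have hK : (0 : ℝ) < K := by exact_mod_cast hKpos
  have hc0 : 0 < c := by linarith
  set ℓ := Real.log (T / δ) with hℓ
  have halive : ∀ t, Alive x φ t j := fun t =>
    ⟨h.two_le j, i, mem_remaining.2 ⟨hi, fun s _ hs => hnot (Finset.mem_image.2 ⟨s,
      Finset.mem_univ _, hs⟩)⟩⟩
  set B := cellsAbove (fun v => - m v) (-M) L K with hB
  set J := Finset.univ.filter (fun k : Fin K => IsFar m M c K k) with hJ
  have hsq : ∑ k ∈ J, (1 / cellGap m M K k) ^ 2 ≤ 2 * (2 * (Q + 1) * K) ^ 2 := by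
    refine sum_inv_sq_le J _ (fun k hk => ?_) fun k hk => ?_
    · have : c / K < cellGap m M K k := (Finset.mem_filter.1 hk).2
      exact lt_trans (by positivity) this
    · have h1 : c / K < cellGap m M K k := (Finset.mem_filter.1 hk).2
      have h2 : L / K ≤ c / K := by gcongr; linarith
      refine le_trans ?_ (card_cellGap_le hLip hL hQ hKpos hmargin
        (lt_trans (by positivity) h1) (h2.trans h1.le))
      exact_mod_cast Finset.card_le_card (Finset.filter_subset_filter _ (Finset.subset_univ J))
  have hnear : ((Finset.univ.filter fun k : Fin K => cellGap m M K k ≤ c / K).card : ℝ) ≤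
      2 * (Q + 1) * c := by
    refine (card_cellGap_le hLip hL hQ hKpos hmargin (by positivity) ?_).trans (le_of_eq ?_)
    · gcongr; linarith
    · field_simp
  have hpull : ∀ k ∈ B, ((allPulls x φ k).card : ℝ) ≤
      (if cellGap m M K k ≤ c / K then 32 * ℓ * K ^ 2 / c ^ 2 else 0) +
      (if IsFar m M c K k then 32 * ℓ * (1 / cellGap m M K k) ^ 2 else 0) + 1 := by
    intro k hk
    by_cases hfar : IsFar m M c K k
    · rw [if_neg (not_le.2 hfar), if_pos hfar, zero_add]
      rcases hfar.side hL hLip (by linarith) with hs | hs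
      · exfalso
        have h1 := (hs _ left_mem_cell).1
        have h2 := mem_cellsAbove.1 hk _ left_mem_cell
        have h3 : c / K < cellGap m M K k := hfar
        have hcK : 8 * (L + 1) / K ≤ c / K := by gcongr
        have e : 8 * (L + 1) / K = 4 * (2 * L / K) + 8 * (1 / K) := by ring
        have : 0 < 1 / (K : ℝ) := by positivity
        have : 0 ≤ 2 * L / (K : ℝ) := by positivity
        linarith
      · exact h.card_allPulls_le_of_far hlog hN hL hc hfar fun v hv => (hs v hv).1
    · rw [if_pos (not_lt.1 hfar), if_neg hfar, add_zero]
      exact h.card_allPulls_le_of_near hlog hL hc hk hj halive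
  -- The near cells contribute the coefficient `8`, the far ones `256`, and the single extra pulls
  -- the term `K`.
  have hsumB : ∑ k ∈ B, ((allPulls x φ k).card : ℝ) ≤ 264 * (Q + 1) ^ 2 * ℓ * K ^ 2 + K := by
    calc ∑ k ∈ B, ((allPulls x φ k).card : ℝ)
        ≤ ∑ k ∈ B, ((if cellGap m M K k ≤ c / K then 32 * ℓ * K ^ 2 / c ^ 2 else 0) +
      (if IsFar m M c K k then 32 * ℓ * (1 / cellGap m M K k) ^ 2 else 0) + 1) :=
          Finset.sum_le_sum hpull
      _ ≤ ∑ k : Fin K, ((if cellGap m M K k ≤ c / K then 32 * ℓ * K ^ 2 / c ^ 2 else 0) +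
      (if IsFar m M c K k then 32 * ℓ * (1 / cellGap m M K k) ^ 2 else 0) + 1) := by
          refine Finset.sum_le_sum_of_subset_of_nonneg (Finset.subset_univ _) fun k _ _ => ?_
          have : 0 ≤ 32 * ℓ * K ^ 2 / c ^ 2 := by positivity
          have : 0 ≤ 32 * ℓ * (1 / cellGap m M K k) ^ 2 := by positivity
          split_ifs <;> linarith
      _ = (Finset.univ.filter fun k : Fin K => cellGap m M K k ≤ c / K).card *
            (32 * ℓ * K ^ 2 / c ^ 2) + 32 * ℓ * ∑ k ∈ J, (1 / cellGap m M K k) ^ 2 + K := by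
          rw [Finset.sum_add_distrib, Finset.sum_add_distrib, ← Finset.sum_filter,
            ← Finset.sum_filter, Finset.sum_const, Finset.sum_const, Finset.mul_sum, hJ]
          simp
      _ ≤ (2 * (Q + 1) * c) * (32 * ℓ * K ^ 2 / c ^ 2) + 32 * ℓ * (2 * (2 * (Q + 1) * K) ^ 2)
            + K := by gcongr
      _ = 64 * (Q + 1) * ℓ * K ^ 2 / c + 256 * (Q + 1) ^ 2 * ℓ * K ^ 2 + K := by
          field_simp; ring
      _ ≤ 8 * (Q + 1) ^ 2 * ℓ * K ^ 2 + 256 * (Q + 1) ^ 2 * ℓ * K ^ 2 + K := by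
          gcongr
          rw [div_le_iff₀ hc0]
          have h8 : 8 ≤ c := by linarith
          have h9 : 0 ≤ (Q + 1) * ℓ * K ^ 2 := by positivity
          have h10 : 8 ≤ (Q + 1) * c := by nlinarith
          nlinarith [mul_le_mul_of_nonneg_left h10 h9]
      _ = _ := by ring
  -- Outside `B` there are too few arms for `T` pulls, and `hbig` prevents `B` from making up the
  -- difference.
  have hsumBc : ∑ k ∈ Bᶜ, ((allPulls x φ k).card : ℝ) ≤ T - 3 * N / (4 * K) := by
    have h1 : ∑ k ∈ Bᶜ, ((allPulls x φ k).card : ℝ) ≤ ∑ k ∈ Bᶜ, ((armsIn x k).card : ℝ) :=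
      Finset.sum_le_sum fun k _ => by exact_mod_cast card_allPulls_le h.typical.inj k
    have h2 : ∑ k ∈ B, ((armsIn x k).card : ℝ) + ∑ k ∈ Bᶜ, ((armsIn x k).card : ℝ) = N := by
      rw [Finset.sum_add_sum_compl]
      have := sum_armsIn (x := x) (f := fun _ => (1 : ℝ)) h.mem_Icc hKpos
      simpa using this
    have := h.card_below
    linarith
  have htot : ∑ k ∈ B, ((allPulls x φ k).card : ℝ) + ∑ k ∈ Bᶜ, ((allPulls x φ k).card : ℝ) = T := by
    rw [Finset.sum_add_sum_compl]
    exact_mod_cast sum_card_allPulls (φ := φ) h.mem_Icc hKpos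
  linarith

open Classical in
theorem regret_le (hlog : 0 ≤ Real.log (T / δ)) (hN : 0 < N) (hKpos : 0 < K) {c : ℝ} (hL : 0 ≤ L)
    (hc : 8 * (L + 1) ≤ c) (hQ : 0 ≤ Q) (hLip : WeaklyLipschitz m M L)
    (hmargin : MarginCondition m M Q) (hM : M ∈ Set.Icc (0 : ℝ) 1)
    (hm : ∀ v ∈ Set.Icc (0 : ℝ) 1, m v ∈ Set.Icc (0 : ℝ) 1)
    (hbig : 264 * (Q + 1) ^ 2 * Real.log (T / δ) * K ^ 2 + K < 3 * N / (4 * K)) :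
    regret m x φ ≤ 8 * (Q + 1) * c ^ 2 * (N / K ^ 2) +
      128 * (Q + 1) * Real.log (T / δ) * K * (1 + Real.log K) + 2 * K := by
  have hK : (0 : ℝ) < K := by exact_mod_cast hKpos
  have hc0 : 0 < c := by linarith
  set ℓ := Real.log (T / δ) with hℓ
  set P := Finset.univ.image φ with hP
  set J := Finset.univ.filter (fun k : Fin K => IsFar m M c K k) with hJ
  have hgap1 : ∀ k : Fin K, cellGap m M K k ≤ 1 := by
    intro k
    have h1 := hm _ (cell_subset_unitInterval (left_mem_cell (k := k)))
    rw [cellGap, abs_le]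
    constructor <;> linarith [h1.1, h1.2, hM.1, hM.2]
  have hinv : ∑ k ∈ J, 1 / cellGap m M K k ≤ 2 * (Q + 1) * K * (1 + Real.log K) := by
    have h0 : ∑ k ∈ J, 1 / cellGap m M K k ≤ 2 * (Q + 1) * K * (1 + Real.log J.card) := by
      refine sum_inv_le J _ (fun k hk => ?_) (by positivity) fun k hk => ?_
      · have : c / K < cellGap m M K k := (Finset.mem_filter.1 hk).2
        exact lt_trans (by positivity) this
      · have h1 : c / K < cellGap m M K k := (Finset.mem_filter.1 hk).2
        have h2 : L / K ≤ c / K := by gcongr; linarith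
        refine le_trans ?_ (card_cellGap_le hLip hL hQ hKpos hmargin
          (lt_trans (by positivity) h1) (h2.trans h1.le))
        exact_mod_cast Finset.card_le_card (Finset.filter_subset_filter _ (Finset.subset_univ J))
    refine h0.trans ?_
    have hJK : J.card ≤ K := by
      have := Finset.card_le_univ J
      rwa [Fintype.card_fin] at this
    rcases Nat.eq_zero_or_pos J.card with h3 | h3
    · rw [h3]
      have h4 : (1 : ℝ) ≤ K := by exact_mod_cast hKpos
      have := Real.log_nonneg h4
      simp only [Nat.cast_zero, Real.log_zero]
      gcongr
    · gcongr
  have hnear : ((Finset.univ.filter fun k : Fin K => cellGap m M K k ≤ c / K).card : ℝ) ≤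
      2 * (Q + 1) * c := by
    refine (card_cellGap_le hLip hL hQ hKpos hmargin (by positivity) ?_).trans (le_of_eq ?_)
    · gcongr; linarith
    · field_simp
  -- The `2` pays for the extra pull in a far cell below the level: its loss is at most twice the
  -- gap, and gaps are at most `1`.
  have hcost : ∀ k : Fin K, levelLoss m M x P (armsIn x k) ≤
      (if cellGap m M K k ≤ c / K then 4 * c * (N / K ^ 2) else 0) +
      (if IsFar m M c K k then 64 * ℓ * (1 / cellGap m M K k) else 0) + 2 := by
    intro k
    by_cases hfar : IsFar m M c K k
    · rw [if_neg (not_le.2 hfar), if_pos hfar, zero_add]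
      have hd : 0 < cellGap m M K k := lt_trans (by positivity) hfar
      rcases hfar.side hL hLip (by linarith) with hs | hs
      · have h0 : levelLoss m M x P (armsIn x k) = 0 := by
          refine Finset.sum_eq_zero fun i hi => ?_
          have hi' := mem_armsIn.1 hi
          rw [if_pos]
          · exact max_eq_right (by linarith [(hs _ hi').1])
          · refine h.exhausted_of_far hlog hN hL hc hQ hLip hmargin hbig (fun v hv => ?_) hi'
            have : c / K < cellGap m M K k := hfar
            linarith [(hs v hv).1]
        rw [h0]
        positivity
      · have h1 := h.card_allPulls_le_of_far hlog hN hL hc hfar fun v hv => (hs v hv).1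
        have h2 : levelLoss m M x P (armsIn x k) ≤
            ((armsIn x k).filter (fun i => i ∈ P)).card * (2 * cellGap m M K k) := by
          rw [← nsmul_eq_mul, ← Finset.sum_const, Finset.sum_filter]
          refine Finset.sum_le_sum fun i hi => ?_
          have hi' := hs _ (mem_armsIn.1 hi)
          split_ifs
          · exact max_le hi'.2 (by positivity)
          · exact max_le (by linarith [hi'.1]) le_rfl
        have h3 : ((armsIn x k).filter (fun i => i ∈ P)).card ≤ (allPulls x φ k).card := by
          refine le_trans (Finset.card_le_card ?_) (Finset.card_image_le (f := φ))
          intro i hi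
          obtain ⟨h4, h5⟩ := Finset.mem_filter.1 hi
          obtain ⟨s, -, rfl⟩ := Finset.mem_image.1 h5
          exact Finset.mem_image.2 ⟨s, mem_allPulls.2 (mem_armsIn.1 h4), rfl⟩
        have h3' : (((armsIn x k).filter (fun i => i ∈ P)).card : ℝ) ≤ (allPulls x φ k).card := by
          exact_mod_cast h3
        calc levelLoss m M x P (armsIn x k)
            ≤ (32 * ℓ * (1 / cellGap m M K k) ^ 2 + 1) * (2 * cellGap m M K k) :=
              h2.trans (mul_le_mul_of_nonneg_right (h3'.trans h1) (by positivity))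
          _ = 64 * ℓ * (1 / cellGap m M K k) + 2 * cellGap m M K k := by
              field_simp; ring
          _ ≤ _ := by linarith [hgap1 k]
    · rw [if_pos (not_lt.1 hfar), if_neg hfar, add_zero]
      have h2 : levelLoss m M x P (armsIn x k) ≤ (armsIn x k).card * (2 * c / K) := by
        rw [← nsmul_eq_mul, ← Finset.sum_const]
        refine Finset.sum_le_sum fun i hi => ?_
        have hi' := abs_le.1 (gap_le_of_not_isFar hL hLip (by linarith : L ≤ c) hfar
          (mem_armsIn.1 hi))
        split_ifs
        · exact max_le (by linarith [hi'.1]) (by positivity)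
        · exact max_le hi'.2 (by positivity)
      calc _ ≤ (armsIn x k).card * (2 * c / K) := h2
        _ ≤ (2 * N / K) * (2 * c / K) := by gcongr; exact h.card_le k
        _ = 4 * c * (N / K ^ 2) := by field_simp; ring
        _ ≤ _ := by linarith
  have hsplit : levelLoss m M x P Finset.univ = ∑ k : Fin K, levelLoss m M x P (armsIn x k) :=
    (sum_armsIn h.mem_Icc hKpos).symm
  calc regret m x φ ≤ ∑ k : Fin K, levelLoss m M x P (armsIn x k) := by
        rw [← hsplit]; exact regret_le_levelLoss h.typical.inj M
    _ ≤ ∑ k : Fin K, ((if cellGap m M K k ≤ c / K then 4 * c * (N / K ^ 2) else 0) +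
          (if IsFar m M c K k then 64 * ℓ * (1 / cellGap m M K k) else 0) + 2) :=
        Finset.sum_le_sum fun k _ => hcost k
    _ = (Finset.univ.filter fun k : Fin K => cellGap m M K k ≤ c / K).card *
          (4 * c * (N / K ^ 2)) + 64 * ℓ * ∑ k ∈ J, 1 / cellGap m M K k + 2 * K := by
        rw [Finset.sum_add_distrib, Finset.sum_add_distrib, ← Finset.sum_filter,
          ← Finset.sum_filter, Finset.sum_const, Finset.sum_const, Finset.mul_sum]
        simp
        ring
    _ ≤ (2 * (Q + 1) * c) * (4 * c * (N / K ^ 2)) +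
          64 * ℓ * (2 * (Q + 1) * K * (1 + Real.log K)) + 2 * K := by gcongr
    _ = _ := by ring

end IsGoodRun

end Regret

/-! ### Concentration of the covariates and of the rewards -/

section Hoeffding

variable {Ω ι : Type*} [MeasurableSpace Ω] {μ : Measure Ω} [IsProbabilityMeasure μ]

lemma measureReal_sum_sub_ge_le {X : ι → Ω → ℝ} (hind : iIndepFun X μ)
    (hm : ∀ i, Measurable (X i)) (hX : ∀ i, ∀ᵐ ω ∂μ, X i ω ∈ Set.Icc (0 : ℝ) 1) (s : Finset ι)
    {r : ℝ} (hr : 0 ≤ r) :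
    μ.real {ω | r ≤ ∑ i ∈ s, (X i ω - μ[X i])} ≤ Real.exp (-(2 * r ^ 2 / s.card)) := by
  have h1 : iIndepFun (fun i ω => X i ω - μ[X i]) μ :=
    hind.comp (fun i (v : ℝ) => v - ∫ ω, X i ω ∂μ) fun i => measurable_id.sub_const _
  have h2 := HasSubgaussianMGF.measure_sum_ge_le_of_iIndepFun h1 (s := s)
    (fun i _ => hasSubgaussianMGF_of_mem_Icc (hm i).aemeasurable (hX i)) hr
  refine h2.trans (le_of_eq ?_)
  congr 1
  simp
  rcases s.eq_empty_or_nonempty with h0 | h0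
  · simp [h0]
  · have : (0 : ℝ) < s.card := by exact_mod_cast h0.card_pos
    field_simp

/-- Hoeffding's inequality, two-sided. -/
lemma measureReal_abs_sum_sub_ge_le {X : ι → Ω → ℝ} (hind : iIndepFun X μ)
    (hm : ∀ i, Measurable (X i)) (hX : ∀ i, ∀ᵐ ω ∂μ, X i ω ∈ Set.Icc (0 : ℝ) 1) (s : Finset ι)
    {r : ℝ} (hr : 0 ≤ r) :
    μ.real {ω | r ≤ |∑ i ∈ s, (X i ω - μ[X i])|} ≤ 2 * Real.exp (-(2 * r ^ 2 / s.card)) := by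
  have hint : ∀ i, Integrable (X i) μ := fun i =>
    Integrable.of_mem_Icc 0 1 (hm i).aemeasurable (hX i)
  have h1 := measureReal_sum_sub_ge_le hind hm hX s hr
  have h2 := measureReal_sum_sub_ge_le (X := fun i ω => 1 - X i ω)
    (hind.comp (fun _ v => 1 - v) fun i => measurable_const.sub measurable_id)
    (fun i => measurable_const.sub (hm i))
    (fun i => by
      filter_upwards [hX i] with ω hω
      exact ⟨by linarith [hω.2], by linarith [hω.1]⟩) s hr
  have h3 : ∀ ω, ∑ i ∈ s, ((1 - X i ω) - μ[fun ω => 1 - X i ω]) =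
      -∑ i ∈ s, (X i ω - μ[X i]) := by
    intro ω
    rw [← Finset.sum_neg_distrib]
    refine Finset.sum_congr rfl fun i _ => ?_
    rw [integral_sub (integrable_const _) (hint i)]
    simp
  simp_rw [h3] at h2
  have hsub : {ω | r ≤ |∑ i ∈ s, (X i ω - μ[X i])|} ⊆
      {ω | r ≤ ∑ i ∈ s, (X i ω - μ[X i])} ∪ {ω | r ≤ -∑ i ∈ s, (X i ω - μ[X i])} := by
    intro ω hω
    rcases le_abs.1 (show r ≤ |∑ i ∈ s, (X i ω - μ[X i])| from hω) with h | h
    · exact Or.inl h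
    · exact Or.inr h
  calc _ ≤ _ := measureReal_mono hsub
    _ ≤ _ := measureReal_union_le _ _
    _ ≤ _ := by linarith

end Hoeffding

/-! ### Counts of arms, and rewards given the covariates -/

section Model

variable {Ω : Type*} [MeasurableSpace Ω] {μ : Measure Ω} [IsProbabilityMeasure μ] {N K : ℕ}
  {m : ℝ → ℝ} {a y : Fin N → Ω → ℝ}

lemma IsModel.map_covariate (h : IsModel μ m a y) (i : Fin N) :
    μ.map (a i) = volume.restrict (Set.Icc (0 : ℝ) 1) := by
  have := h.uniform_covariate i
  rw [pdf.IsUniform, ProbabilityTheory.cond] at this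
  simpa using this

lemma IsModel.ae_covariate_mem (h : IsModel μ m a y) :
    ∀ᵐ ω ∂μ, ∀ i, a i ω ∈ Set.Icc (0 : ℝ) 1 := by
  rw [ae_all_iff]
  intro i
  refine ae_of_ae_map (h.measurable_covariate i).aemeasurable (p := fun v => v ∈ Set.Icc (0 : ℝ) 1) ?_
  rw [h.map_covariate i]
  exact ae_restrict_mem measurableSet_Icc

/-- The number of arms in a union of cells. -/
lemma sum_card_armsIn_eq (x : Fin N → ℝ) (J : Finset (Fin K)) :
    ∑ k ∈ J, ((armsIn x k).card : ℝ) =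
      ∑ i, Set.indicator (⋃ k ∈ J, cell K k) (fun _ => (1 : ℝ)) (x i) := by
  classical
  have h1 : ∀ k : Fin K, ((armsIn x k).card : ℝ) = ∑ i, if x i ∈ cell K k then (1 : ℝ) else 0 := by
    intro k
    rw [Finset.sum_boole]
    rfl
  simp_rw [h1]
  rw [Finset.sum_comm]
  refine Finset.sum_congr rfl fun i _ => ?_
  by_cases h : ∃ k ∈ J, x i ∈ cell K k
  · obtain ⟨k, hk, hxk⟩ := h
    rw [Set.indicator_of_mem (by simp only [Set.mem_iUnion]; exact ⟨k, hk, hxk⟩),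
      Finset.sum_eq_single_of_mem k hk, if_pos hxk]
    intro j _ hjk
    rw [if_neg]
    exact fun hj => hjk (cell_unique hj hxk)
  · rw [Set.indicator_of_notMem (by simp only [Set.mem_iUnion]; rintro ⟨k, hk, hx⟩; exact h ⟨k, hk, hx⟩)]
    exact Finset.sum_eq_zero fun k hk => if_neg fun hx => h ⟨k, hk, hx⟩

lemma IsModel.measureReal_count_dev_le (h : IsModel μ m a y) (J : Finset (Fin K)) {r : ℝ}
    (hr : 0 ≤ r) :
    μ.real {ω | r ≤ |∑ k ∈ J, ((armsIn (fun i => a i ω) k).card : ℝ) - N * (J.card / K)|} ≤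
      2 * Real.exp (-(2 * r ^ 2 / N)) := by
  set S := ⋃ k ∈ J, cell K k with hS
  have hSm : MeasurableSet S := Finset.measurableSet_biUnion J fun k _ => measurableSet_cell
  have hfm : Measurable (Set.indicator S (fun _ => (1 : ℝ))) := measurable_const.indicator hSm
  have hmean : ∀ i, ∫ ω, Set.indicator S (fun _ => (1 : ℝ)) (a i ω) ∂μ = (J.card : ℝ) / K := by
    intro i
    rw [← integral_map (h.measurable_covariate i).aemeasurable hfm.aestronglyMeasurable,
      h.map_covariate i, integral_indicator hSm, Measure.restrict_restrict hSm]
    have : S ∩ Set.Icc 0 1 = S := by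
      rw [Set.inter_eq_left]
      exact Set.iUnion₂_subset fun k _ => cell_subset_unitInterval
    rw [this]
    simp only [integral_const, smul_eq_mul, mul_one, measureReal_restrict_apply, MeasurableSet.univ,
      Set.univ_inter]
    rw [Measure.real, hS, volume_biUnion_cell, ENNReal.toReal_ofReal (by positivity)]
  have h1 := measureReal_abs_sum_sub_ge_le (μ := μ)
    (X := fun i ω => Set.indicator S (fun _ => (1 : ℝ)) (a i ω))
    (h.indep_covariate.comp (fun _ => Set.indicator S (fun _ => (1 : ℝ))) fun _ => hfm)
    (fun i => hfm.comp (h.measurable_covariate i))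
    (fun i => Filter.Eventually.of_forall fun ω => by
      by_cases hmem : a i ω ∈ S <;> simp [hmem]) Finset.univ hr
  simp_rw [hmean] at h1
  simp_rw [sum_card_armsIn_eq]
  simpa [Finset.sum_sub_distrib] using h1

/-- Given the covariates, the arms of the cell are fixed and the rewards follow a product law, so
Hoeffding applies to each section and the bound is integrated. Restricting to at least `b` arms
makes it uniform in the covariates. -/
lemma IsModel.measureReal_reward_dev_le (h : IsModel μ m a y) (hm : Measurable m) (k : Fin K)
    {b r : ℝ} (hb : 0 ≤ b) (hr : 0 ≤ r) :
    μ.real {ω | b ≤ (armsIn (fun i => a i ω) k).card ∧ (armsIn (fun i => a i ω) k).card * r ≤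
      |∑ i ∈ armsIn (fun i => a i ω) k, (y i ω - m (a i ω))|} ≤
      2 * Real.exp (-(2 * b * r ^ 2)) := by
  set S : Set ((Fin N → ℝ) × (Fin N → ℝ)) :=
    {q | b ≤ (armsIn q.1 k).card ∧ (armsIn q.1 k).card * r ≤
      |∑ i ∈ armsIn q.1 k, (q.2 i - m (q.1 i))|} with hS
  have hcoord : ∀ i, Measurable fun q : (Fin N → ℝ) × (Fin N → ℝ) => q.1 i := fun i =>
    (measurable_pi_apply i).comp measurable_fst
  have hSm : MeasurableSet S := by
    have hA :=
      measurable_armsIn (a := fun i (q : (Fin N → ℝ) × (Fin N → ℝ)) => q.1 i) hcoord k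
    have h1 : Measurable fun q : (Fin N → ℝ) × (Fin N → ℝ) => ((armsIn q.1 k).card : ℝ) :=
      measurable_comp_finset hA (f := fun A _ => (A.card : ℝ)) fun A => measurable_const
    have h2 : Measurable fun q : (Fin N → ℝ) × (Fin N → ℝ) =>
        ∑ i ∈ armsIn q.1 k, (q.2 i - m (q.1 i)) :=
      measurable_comp_finset hA (f := fun A q => ∑ i ∈ A, (q.2 i - m (q.1 i))) fun A =>
        Finset.measurable_fun_sum A fun i _ =>
          ((measurable_pi_apply i).comp measurable_snd).sub (hm.comp (hcoord i))
    exact (measurableSet_le measurable_const h1).inter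
      (measurableSet_le (h1.mul_const r) (continuous_abs.measurable.comp h2))
  have ham : Measurable fun ω i => a i ω := measurable_pi_lambda _ h.measurable_covariate
  have hym : Measurable fun ω i => y i ω := measurable_pi_lambda _ h.measurable_reward
  have hjoint := compProd_map_condDistrib (μ := μ) (mβ := MeasurableSpace.pi) (X := fun ω i => a i ω)
    (Y := fun ω i => y i ω) hym.aemeasurable
  have hbound01 : ∀ᵐ x ∂(μ.map fun ω i => a i ω),
      ∀ᵐ v ∂(condDistrib (fun ω i => y i ω) (fun ω i => a i ω) μ x),
        ∀ i, v i ∈ Set.Icc (0 : ℝ) 1 := by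
    have hset : MeasurableSet {q : (Fin N → ℝ) × (Fin N → ℝ) | ∀ i, q.2 i ∈ Set.Icc (0 : ℝ) 1} := by
      rw [Set.ofPred_forall]
      exact MeasurableSet.iInter fun i =>
        ((measurable_pi_apply i).comp measurable_snd) measurableSet_Icc
    refine Measure.ae_ae_of_ae_compProd
      (p := fun q : (Fin N → ℝ) × (Fin N → ℝ) => ∀ i, q.2 i ∈ Set.Icc (0 : ℝ) 1) ?_
    rw [hjoint, ae_map_iff (ham.prodMk hym).aemeasurable hset, ae_all_iff]
    exact h.reward_mem
  have hcond : ∀ᵐ x ∂(μ.map fun ω i => a i ω),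
      condDistrib (fun ω i => y i ω) (fun ω i => a i ω) μ x (Prod.mk x ⁻¹' S) ≤
        ENNReal.ofReal (2 * Real.exp (-(2 * b * r ^ 2))) := by
    filter_upwards [h.reward_law, hbound01] with x ⟨η, hη, hmean⟩ h01
    rw [hη] at h01 ⊢
    set A := armsIn x k with hA
    set ν := Measure.pi (fun i => (η i : Measure ℝ)) with hν
    by_cases hbA : b ≤ A.card
    · have hmeas : ∀ i, Measurable fun v : Fin N → ℝ => v i := fun i => measurable_pi_apply i
      have hind : iIndepFun (fun (i : Fin N) (v : Fin N → ℝ) => v i) ν :=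
        iIndepFun_pi (X := fun _ v => v) fun i => aemeasurable_id
      have hE : ∀ i, ν[fun v => v i] = m (x i) := by
        intro i
        rw [← hmean i]
        have hmp := measurePreserving_eval (fun i => (η i : Measure ℝ)) i
        rw [← hmp.map_eq]
        exact (integral_map (φ := Function.eval i) (f := fun v : ℝ => v) (hmeas i).aemeasurable
          aestronglyMeasurable_id).symm
      have h1 := measureReal_abs_sum_sub_ge_le hind hmeas
        (fun i => by filter_upwards [h01] with v hv using hv i) A
        (r := A.card * r) (by positivity)
      simp_rw [hE] at h1
      have h2 : Prod.mk x ⁻¹' S ⊆ {v | A.card * r ≤ |∑ i ∈ A, (v i - m (x i))|} :=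
        fun v hv => hv.2
      refine (measure_mono h2).trans ?_
      rw [← ofReal_measureReal]
      refine ENNReal.ofReal_le_ofReal (h1.trans ?_)
      have h3 : 2 * b * r ^ 2 ≤ 2 * ((A.card : ℝ) * r) ^ 2 / A.card := by
        rcases Nat.eq_zero_or_pos A.card with h0 | h0
        · have hb0 : b = 0 := le_antisymm (by simpa [h0] using hbA) hb
          simp [h0, hb0]
        · have : (0 : ℝ) < A.card := by exact_mod_cast h0
          have e : 2 * ((A.card : ℝ) * r) ^ 2 / A.card = 2 * A.card * r ^ 2 := by
            field_simp
          rw [e]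
          gcongr
      gcongr
    · have : Prod.mk x ⁻¹' S = ∅ := by
        ext v
        simp only [Set.mem_preimage, Set.mem_empty_iff_false, iff_false]
        exact fun hv => hbA hv.1
      rw [this, measure_empty]
      positivity
  have hprob : IsProbabilityMeasure (μ.map fun ω i => a i ω) :=
    Measure.isProbabilityMeasure_map ham.aemeasurable
  have hpre : {ω | b ≤ (armsIn (fun i => a i ω) k).card ∧ (armsIn (fun i => a i ω) k).card * r ≤
      |∑ i ∈ armsIn (fun i => a i ω) k, (y i ω - m (a i ω))|} =
      (fun ω => ((fun i => a i ω), fun i => y i ω)) ⁻¹' S := rfl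
  rw [hpre, Measure.real]
  refine ENNReal.toReal_le_of_le_ofReal (by positivity) ?_
  rw [← Measure.map_apply (ham.prodMk hym) hSm, ← hjoint, Measure.compProd_apply hSm]
  calc _ ≤ ∫⁻ _, ENNReal.ofReal (2 * Real.exp (-(2 * b * r ^ 2))) ∂(μ.map fun ω i => a i ω) :=
        lintegral_mono_ae hcond
    _ = _ := by simp

end Model

/-! ### A run is good with high probability -/

section GoodEvent

variable {Ω : Type*} [MeasurableSpace Ω] {μ : Measure Ω} [IsProbabilityMeasure μ] {N T K : ℕ}
  {m : ℝ → ℝ} {M L p δ : ℝ} {a y : Fin N → Ω → ℝ} {φ : Fin T → Ω → Fin N} {κ : Fin T → Ω → Fin K}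

/-- The rewards, truncated to the unit interval. -/
def truncReward (y : Fin N → Ω → ℝ) (i : Fin N) (ω : Ω) : ℝ := max 0 (min 1 (y i ω))

omit [MeasurableSpace Ω] in
lemma truncReward_mem (i : Fin N) (ω : Ω) : truncReward y i ω ∈ Set.Icc (0 : ℝ) 1 :=
  ⟨le_max_left _ _, max_le zero_le_one (min_le_left _ _)⟩

omit [MeasurableSpace Ω] in
lemma truncReward_eq {i : Fin N} {ω : Ω} (h : y i ω ∈ Set.Icc (0 : ℝ) 1) :
    truncReward y i ω = y i ω := by
  rw [truncReward, min_eq_right h.2, max_eq_right h.1]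

omit [MeasurableSpace Ω] in
lemma measurable_truncReward {m' : MeasurableSpace Ω} {i : Fin N} (h : Measurable[m'] (y i)) :
    Measurable[m'] (truncReward y i) :=
  measurable_const.max (measurable_const.min h)

/-- The radius of the confidence interval after `n` pulls. -/
def confRadius (T : ℕ) (δ : ℝ) (n : ℕ) : ℝ := Real.sqrt (Real.log (T / δ) / (2 * n))

/-- The event that the average reward observed in the `k`-th interval after `n` pulls deviates too
much from the average reward of its arms. -/
def samplingFailure (a y : Fin N → Ω → ℝ) (φ : Fin T → Ω → Fin N) (κ : Fin T → Ω → Fin K) (δ : ℝ)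
    (k : Fin K) (n : ℕ) : Set Ω :=
  {ω | (leftAfter a φ κ k n T ω).card + n = (armsIn (fun i => a i ω) k).card ∧
    n * confRadius T δ n ≤ |pullDeviation a (truncReward y) φ κ k n ω|}

/-- The radius is tuned so that each tail has mass at most `δ / T`. Rewards are truncated because
the supermartingale needs them in the unit interval at every outcome. -/
lemma measureReal_samplingFailure_le (hmodel : IsModel μ m a y) (hrun : IsUCBFRun μ δ a y φ κ)
    (hT : 0 < T) (hδ : 0 < δ) (hlog : 0 ≤ Real.log (T / δ)) (k : Fin K) {n : ℕ} (hn : 0 < n) :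
    μ.real (samplingFailure a y φ κ δ k n) ≤ 2 * (δ / T) := by
  have hT' : (0 : ℝ) < T := by exact_mod_cast hT
  have hn' : (0 : ℝ) < n := by exact_mod_cast hn
  have hexp : Real.exp (-(2 * n * confRadius T δ n ^ 2)) = δ / T := by
    rw [confRadius, Real.sq_sqrt (by positivity)]
    have : 2 * (n : ℝ) * (Real.log (T / δ) / (2 * n)) = Real.log (T / δ) := by field_simp
    rw [this, Real.exp_neg, Real.exp_log (by positivity), inv_div]
  have hone : ∀ σ : ℝ, σ ^ 2 = 1 → μ.real {ω | (leftAfter a φ κ k n T ω).card + n =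
      (armsIn (fun i => a i ω) k).card ∧
        n * confRadius T δ n ≤ σ * pullDeviation a (truncReward y) φ κ k n ω} ≤ δ / T := by
    intro σ hσ
    rw [← hexp]
    exact measureReal_pullDeviation_ge_le hrun hmodel.measurable_covariate
      hmodel.measurable_reward truncReward_mem
      (fun t i => measurable_truncReward ((measurable_beforeDraw t).2.1 i))
      (fun i => measurable_truncReward (hmodel.measurable_reward i)) k n
      (Real.sqrt_nonneg _) hσ
  have hsub : samplingFailure a y φ κ δ k n ⊆
      {ω | (leftAfter a φ κ k n T ω).card + n = (armsIn (fun i => a i ω) k).card ∧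
        n * confRadius T δ n ≤ 1 * pullDeviation a (truncReward y) φ κ k n ω} ∪
      {ω | (leftAfter a φ κ k n T ω).card + n = (armsIn (fun i => a i ω) k).card ∧
        n * confRadius T δ n ≤ -1 * pullDeviation a (truncReward y) φ κ k n ω} := by
    rintro ω ⟨h1, h2⟩
    rcases le_abs.1 h2 with h | h
    · exact Or.inl ⟨h1, by rwa [one_mul]⟩
    · exact Or.inr ⟨h1, by rwa [neg_one_mul]⟩
  calc _ ≤ _ := measureReal_mono hsub
    _ ≤ _ := measureReal_union_le _ _
    _ ≤ δ / T + δ / T := add_le_add (hone 1 (by norm_num)) (hone (-1) (by norm_num))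
    _ = _ := by ring

lemma IsUCBFRun.ae_isTypicalRun (hmodel : IsModel μ m a y) (hrun : IsUCBFRun μ δ a y φ κ)
    (hK : 0 < K) (hTN : T < N) :
    ∀ᵐ ω ∂μ, (∀ k : Fin K, 2 ≤ (armsIn (fun i => a i ω) k).card) →
      IsTypicalRun δ (fun i => a i ω) (fun i => y i ω) (fun t => φ t ω) (fun t => κ t ω) := by
  have h1 := ae_all_iff.2 hrun.choice
  have h2 := ae_all_iff.2 fun t =>
    hrun.ae_mem_remaining hmodel.measurable_covariate hmodel.measurable_reward t
  filter_upwards [hrun.injective, h1, h2, hmodel.ae_covariate_mem] with ω hinj hch hmem hx htwo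
  have hch' : ∀ t, IsChoice δ (fun i => a i ω) (fun i => y i ω) (fun s => φ s ω) t (κ t ω) :=
    fun t => hch t (exists_alive_of_card_lt hx hK htwo hTN t)
  exact ⟨hinj, hch', fun t => hmem t (hch' t).1⟩

/-- The event that the number of arms in a union of cells is far from its mean. -/
def countFailure (a : Fin N → Ω → ℝ) (J : Finset (Fin K)) (r : ℝ) : Set Ω :=
  {ω | r ≤ |∑ k ∈ J, ((armsIn (fun i => a i ω) k).card : ℝ) - N * (J.card / K)|}

/-- The event that the average reward of the arms of a cell is far from their average mean. -/
def rewardFailure (m : ℝ → ℝ) (a y : Fin N → Ω → ℝ) (k : Fin K) : Set Ω :=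
  {ω | (N : ℝ) / (2 * K) ≤ (armsIn (fun i => a i ω) k).card ∧
    (armsIn (fun i => a i ω) k).card * (1 / (K : ℝ)) ≤
      |∑ i ∈ armsIn (fun i => a i ω) k, (y i ω - m (a i ω))|}

/-- A deviation below `N / (2 * K)` keeps each count within a factor of the mean `N / K`. For the
two large families, the extra cell is worth `N / K`, and a deviation of `N / (4 * K)` leaves the
slack `3 * N / (4 * K)`. -/
lemma ae_isGoodRun (hmodel : IsModel μ m a y) (hrun : IsUCBFRun μ δ a y φ κ)
    (hp : p ∈ Set.Ioo (0 : ℝ) 1) (hTp : (T : ℝ) = p * N) (hK : 0 < K) (hN : 4 * (K : ℝ) ≤ N)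
    (habove : p * K + 1 ≤ (cellsAbove m M L K).card)
    (hbelow : (1 - p) * K + 1 ≤ (cellsAbove (fun v => - m v) (-M) L K).card) :
    ∀ᵐ ω ∂μ, ω ∉ (⋃ k ∈ (Finset.univ : Finset (Fin K)), countFailure a {k} ((N : ℝ) / (2 * K))) →
      ω ∉ countFailure a (cellsAbove m M L K) ((N : ℝ) / (4 * K)) →
      ω ∉ countFailure a (cellsAbove (fun v => - m v) (-M) L K) ((N : ℝ) / (4 * K)) →
      ω ∉ (⋃ k ∈ (Finset.univ : Finset (Fin K)), rewardFailure m a y k) →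
      ω ∉ (⋃ q ∈ (Finset.univ : Finset (Fin K)) ×ˢ Finset.Icc 1 T,
        samplingFailure a y φ κ δ q.1 q.2) →
      IsGoodRun m M L δ (fun i => a i ω) (fun i => y i ω) (fun t => φ t ω) (fun t => κ t ω) := by
  have hK' : (0 : ℝ) < K := by exact_mod_cast hK
  have hN' : (0 : ℝ) < N := by linarith
  have hTN : T < N := by
    have : (T : ℝ) < N := by rw [hTp]; nlinarith [hp.2]
    exact_mod_cast this
  filter_upwards [hrun.ae_isTypicalRun hmodel hK hTN, hmodel.ae_covariate_mem,
    ae_all_iff.2 hmodel.reward_mem] with ω htyp hx hy h1 h2 h3 h4 h5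
  simp only [Set.mem_iUnion, Finset.mem_univ, exists_prop, true_and, not_exists] at h1 h4
  have hcell : ∀ k : Fin K, (N : ℝ) / (2 * K) < (armsIn (fun i => a i ω) k).card ∧
      ((armsIn (fun i => a i ω) k).card : ℝ) ≤ 2 * N / K := by
    intro k
    have h := h1 k
    simp only [countFailure, Set.mem_ofPred_eq, not_le, Finset.sum_singleton,
      Finset.card_singleton, Nat.cast_one] at h
    rw [abs_lt] at h
    have e1 : (N : ℝ) * (1 / K) = N / (2 * K) + N / (2 * K) := by field_simp; ring
    have e2 : 2 * (N : ℝ) / K = 4 * (N / (2 * K)) := by field_simp; ring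
    have : 0 < (N : ℝ) / (2 * K) := by positivity
    rw [e1] at h
    rw [e2]
    constructor <;> linarith [h.1, h.2]
  have htwo : ∀ k : Fin K, 2 ≤ (armsIn (fun i => a i ω) k).card := by
    intro k
    have h := (hcell k).1
    have : (2 : ℝ) ≤ N / (2 * K) := by rw [le_div_iff₀ (by positivity)]; linarith
    have : (2 : ℝ) < (armsIn (fun i => a i ω) k).card := by linarith
    exact_mod_cast this.le
  have htypical := htyp htwo
  have hcount : ∀ (J : Finset (Fin K)) (q : ℝ), q * K + 1 ≤ J.card →
      ω ∉ countFailure a J ((N : ℝ) / (4 * K)) →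
      q * N + 3 * N / (4 * K) ≤ ∑ k ∈ J, ((armsIn (fun i => a i ω) k).card : ℝ) := by
    intro J q hJ hω
    simp only [countFailure, Set.mem_ofPred_eq, not_le] at hω
    rw [abs_lt] at hω
    have e1 : (N : ℝ) * ((q * K + 1) / K) = q * N + 3 * N / (4 * K) + N / (4 * K) := by
      field_simp; ring
    have e2 : (N : ℝ) * ((q * K + 1) / K) ≤ N * (J.card / K) := by gcongr
    linarith [hω.1]
  refine ⟨htypical, hx, htwo, fun k => (hcell k).2, ?_, ?_, ?_⟩
  · rw [hTp]
    exact hcount _ _ habove h2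
  · have e : (N : ℝ) - T = (1 - p) * N := by rw [hTp]; ring
    rw [e]
    exact hcount _ _ hbelow h3
  · intro t k hne
    set n := (pullTimes (fun i => a i ω) (fun t => φ t ω) t k).card with hn
    have hA : (0 : ℝ) < (armsIn (fun i => a i ω) k).card :=
      lt_of_le_of_lt (by positivity) (hcell k).1
    have hnT : n ∈ Finset.Icc 1 T := by
      rw [Finset.mem_Icc]
      refine ⟨hne.card_pos, ?_⟩
      have := Finset.card_le_univ (pullTimes (fun i => a i ω) (fun t => φ t ω) t k)
      rwa [Fintype.card_fin] at this
    have hsamp : ω ∉ samplingFailure a y φ κ δ k n := by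
      intro hmem
      apply h5
      simp only [Set.mem_iUnion]
      exact ⟨(k, n), Finset.mem_product.2 ⟨Finset.mem_univ _, hnT⟩, hmem⟩
    have hcard := htypical.card_add t k
    have hleft : leftAfter a φ κ k n T ω =
        remaining (fun i => a i ω) (fun s => φ s ω) t k := by
      have := htypical.stoppedLeft_end k t
      have e : (remaining (fun i => a i ω) (fun s => φ s ω) t k).card =
        (armsIn (fun i => a i ω) k).card - n := by omega
      rw [e] at this
      exact this
    have hdev : |pullDeviation a (truncReward y) φ κ k n ω| ≤ n * confRadius T δ n := by
      by_contra! hlt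
      exact hsamp ⟨by rw [hleft]; exact hcard, hlt.le⟩
    have htr : (fun i => truncReward y i ω) = fun i => y i ω :=
      funext fun i => truncReward_eq (hy i)
    have hemp : |empMean (fun i => a i ω) (fun i => y i ω) (fun s => φ s ω) t k -
        (∑ i ∈ armsIn (fun i => a i ω) k, y i ω) / (armsIn (fun i => a i ω) k).card| ≤
        confRadius T δ n := by
      refine htypical.abs_empMean_sub_le k t hne ?_
      rw [← htr]
      exact hdev
    have hrew : |(∑ i ∈ armsIn (fun i => a i ω) k, y i ω) / (armsIn (fun i => a i ω) k).card -
        cellMean m (fun i => a i ω) k| ≤ 1 / K := by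
      have h6 := h4 k
      simp only [rewardFailure, Set.mem_ofPred_eq, not_and, not_le] at h6
      have h7 := h6 (hcell k).1.le
      rw [cellMean, ← sub_div, ← Finset.sum_sub_distrib, abs_div, abs_of_pos hA,
        div_le_iff₀ hA, mul_comm]
      exact h7.le
    calc _ = |(empMean (fun i => a i ω) (fun i => y i ω) (fun s => φ s ω) t k -
          (∑ i ∈ armsIn (fun i => a i ω) k, y i ω) / (armsIn (fun i => a i ω) k).card) +
          ((∑ i ∈ armsIn (fun i => a i ω) k, y i ω) / (armsIn (fun i => a i ω) k).card -
          cellMean m (fun i => a i ω) k)| := by congr 1; ring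
      _ ≤ _ := abs_add_le _ _
      _ ≤ _ := add_le_add hemp hrew

lemma measureReal_not_isGoodRun_le (hmodel : IsModel μ m a y) (hrun : IsUCBFRun μ δ a y φ κ)
    (hm : Measurable m) (hp : p ∈ Set.Ioo (0 : ℝ) 1) (hTp : (T : ℝ) = p * N) (hK : 0 < K)
    (hN : 4 * (K : ℝ) ≤ N) (hδ : 0 < δ) (hlog : 0 ≤ Real.log (T / δ))
    (habove : p * K + 1 ≤ (cellsAbove m M L K).card)
    (hbelow : (1 - p) * K + 1 ≤ (cellsAbove (fun v => - m v) (-M) L K).card) :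
    μ.real {ω | ¬ IsGoodRun m M L δ (fun i => a i ω) (fun i => y i ω) (fun t => φ t ω)
      (fun t => κ t ω)} ≤
      2 * K * Real.exp (-(N / (2 * K ^ 2))) + 4 * Real.exp (-(N / (8 * K ^ 2))) +
        2 * K * Real.exp (-(N / K ^ 3)) + 2 * K * δ := by
  have hK' : (0 : ℝ) < K := by exact_mod_cast hK
  have hN' : (0 : ℝ) < N := by linarith
  have hT' : (0 : ℝ) < T := by rw [hTp]; exact mul_pos hp.1 hN'
  have hT : 0 < T := by exact_mod_cast hT'
  set F1 := ⋃ k ∈ (Finset.univ : Finset (Fin K)), countFailure a {k} ((N : ℝ) / (2 * K)) with hF1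
  set F2 := countFailure a (cellsAbove m M L K) ((N : ℝ) / (4 * K)) with hF2
  set F3 := countFailure a (cellsAbove (fun v => - m v) (-M) L K) ((N : ℝ) / (4 * K)) with hF3
  set F4 := ⋃ k ∈ (Finset.univ : Finset (Fin K)), rewardFailure m a y k with hF4
  set F5 := ⋃ q ∈ (Finset.univ : Finset (Fin K)) ×ˢ Finset.Icc 1 T,
    samplingFailure a y φ κ δ q.1 q.2 with hF5
  have hsub : ({ω | ¬ IsGoodRun m M L δ (fun i => a i ω) (fun i => y i ω) (fun t => φ t ω)
      (fun t => κ t ω)} : Set Ω) ≤ᵐ[μ] (F1 ∪ F2 ∪ F3 ∪ F4 ∪ F5 : Set Ω) := by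
    filter_upwards [ae_isGoodRun (M := M) (L := L) hmodel hrun hp hTp hK hN habove hbelow]
      with ω hω hbad
    by_contra hcon
    have hcon' : ω ∉ F1 ∪ F2 ∪ F3 ∪ F4 ∪ F5 := hcon
    simp only [Set.mem_union, not_or] at hcon'
    obtain ⟨⟨⟨⟨h1, h2⟩, h3⟩, h4⟩, h5⟩ := hcon'
    exact hbad (hω h1 h2 h3 h4 h5)
  have hle : μ.real {ω | ¬ IsGoodRun m M L δ (fun i => a i ω) (fun i => y i ω) (fun t => φ t ω)
      (fun t => κ t ω)} ≤ μ.real (F1 ∪ F2 ∪ F3 ∪ F4 ∪ F5) :=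
    ENNReal.toReal_mono (measure_ne_top _ _) (measure_mono_ae hsub)
  have b1 : μ.real F1 ≤ 2 * K * Real.exp (-(N / (2 * K ^ 2))) := by
    refine (measureReal_biUnion_finset_le _ _).trans ?_
    refine (Finset.sum_le_card_nsmul _ _ (2 * Real.exp (-(N / (2 * K ^ 2)))) fun k _ => ?_).trans
      (le_of_eq ?_)
    · refine (hmodel.measureReal_count_dev_le {k} (by positivity)).trans (le_of_eq ?_)
      congr 3
      field_simp
    · simp; ring
  have b23 : ∀ J : Finset (Fin K), μ.real (countFailure a J ((N : ℝ) / (4 * K))) ≤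
      2 * Real.exp (-(N / (8 * K ^ 2))) := by
    intro J
    refine (hmodel.measureReal_count_dev_le J (by positivity)).trans (le_of_eq ?_)
    congr 3
    field_simp
    ring
  have b4 : μ.real F4 ≤ 2 * K * Real.exp (-(N / K ^ 3)) := by
    refine (measureReal_biUnion_finset_le _ _).trans ?_
    refine (Finset.sum_le_card_nsmul _ _ (2 * Real.exp (-(N / K ^ 3))) fun k _ => ?_).trans
      (le_of_eq ?_)
    · refine (hmodel.measureReal_reward_dev_le hm k (b := (N : ℝ) / (2 * K)) (r := 1 / (K : ℝ))
        (by positivity) (by positivity)).trans (le_of_eq ?_)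
      congr 3
      field_simp
    · simp; ring
  -- There are `K * T` pairs of a cell and a number of pulls, each of probability at most `2 * (δ /
  -- T)`.
  have b5 : μ.real F5 ≤ 2 * K * δ := by
    refine (measureReal_biUnion_finset_le _ _).trans ?_
    refine (Finset.sum_le_card_nsmul _ _ (2 * (δ / T)) fun q hq => ?_).trans (le_of_eq ?_)
    · exact measureReal_samplingFailure_le hmodel hrun hT hδ hlog q.1
        (Finset.mem_Icc.1 (Finset.mem_product.1 hq).2).1
    · rw [Finset.card_product, nsmul_eq_mul]
      simp
      field_simp
  have u1 := measureReal_union_le (μ := μ) F1 F2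
  have u2 := measureReal_union_le (μ := μ) (F1 ∪ F2) F3
  have u3 := measureReal_union_le (μ := μ) (F1 ∪ F2 ∪ F3) F4
  have u4 := measureReal_union_le (μ := μ) (F1 ∪ F2 ∪ F3 ∪ F4) F5
  have b2 := b23 (cellsAbove m M L K)
  have b3 := b23 (cellsAbove (fun v => - m v) (-M) L K)
  linarith

end GoodEvent

/-! ### Asymptotics of the parameters -/

section Parameters

variable {N : ℕ}

lemma exists_roots (hN : 2 ≤ N) : ∃ A w : ℝ, 0 < A ∧ 0 < w ∧ (N : ℝ) = A ^ 3 ∧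
    Real.log N = w ^ 3 ∧ (N : ℝ) ^ (1 / 3 : ℝ) = A ∧ Real.log N ^ (4 / 3 : ℝ) = w ^ 4 ∧
    Real.log N ^ (-(2 / 3) : ℝ) = (w ^ 2)⁻¹ := by
  have hN' : (1 : ℝ) < N := by exact_mod_cast hN
  have hlog := Real.log_pos hN'
  refine ⟨(N : ℝ) ^ (1 / 3 : ℝ), Real.log N ^ (1 / 3 : ℝ), by positivity, by positivity,
    ?_, ?_, rfl, ?_, ?_⟩
  · rw [← Real.rpow_natCast, ← Real.rpow_mul (by positivity)]; norm_num
  · rw [← Real.rpow_natCast, ← Real.rpow_mul hlog.le]; norm_num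
  · rw [← Real.rpow_natCast, ← Real.rpow_mul hlog.le]; norm_num
  · rw [← Real.rpow_natCast, ← Real.rpow_mul hlog.le, ← Real.rpow_neg hlog.le]; norm_num

/-- Ensures `1 ≤ log N`. For `N = 2` three cells would require `27 * log 2 ^ 2 ≤ 2`; for `N ≤ 1` the
formula takes the value `0`. -/
lemma three_le_of_numCells (h : 2 < numCells N) : 3 ≤ N := by
  by_contra! hlt
  have hN2 : N = 2 := by
    by_contra hne
    have : N = 0 ∨ N = 1 := by omega
    rcases this with rfl | rfl
    · simp [numCells] at h
    · simp [numCells] at h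
  subst hN2
  obtain ⟨A, w, hA, hw, hN, hlog, hA', -, hw'⟩ := exists_roots (le_refl 2)
  have hK : (numCells 2 : ℝ) ≤ A * (w ^ 2)⁻¹ := by
    rw [← hA', ← hw']
    exact Nat.floor_le (by positivity)
  have h3 : (3 : ℝ) ≤ numCells 2 := by exact_mod_cast h
  have h4 : 3 * w ^ 2 ≤ A := by
    have := h3.trans hK
    rwa [← div_eq_mul_inv, le_div_iff₀ (by positivity)] at this
  have h5 : (3 * w ^ 2) ^ 3 ≤ A ^ 3 := by gcongr
  have h6 : (3 * w ^ 2) ^ 3 = 27 * (w ^ 3) ^ 2 := by ring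
  rw [h6, ← hlog, ← hN] at h5
  have h7 := Real.log_two_gt_d9
  push_cast at h5
  nlinarith

/-- The number of cells in terms of the cubic roots of `N` and `log N`. -/
lemma numCells_bounds (h : 2 < numCells N) : ∃ A w : ℝ, 0 < A ∧ 1 ≤ w ∧ (N : ℝ) = A ^ 3 ∧
    Real.log N = w ^ 3 ∧ (N : ℝ) ^ (1 / 3 : ℝ) = A ∧ Real.log N ^ (4 / 3 : ℝ) = w ^ 4 ∧
    (numCells N : ℝ) * w ^ 2 ≤ A ∧ A ≤ 2 * numCells N * w ^ 2 := by
  have h3 := three_le_of_numCells h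
  obtain ⟨A, w, hA, hw, hN, hlog, hA', hw4, hw'⟩ := exists_roots (by omega : 2 ≤ N)
  have hw1 : 1 ≤ w := by
    have h4 : (1 : ℝ) ≤ Real.log N := by
      rw [Real.le_log_iff_exp_le (by positivity)]
      have : (3 : ℝ) ≤ N := by exact_mod_cast h3
      linarith [Real.exp_one_lt_d9]
    rw [hlog] at h4
    by_contra! hlt
    have : w ^ 3 < 1 := pow_lt_one₀ hw.le hlt (by norm_num)
    linarith
  have hKdef : numCells N = ⌊A * (w ^ 2)⁻¹⌋₊ := by rw [numCells, hA', hw']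
  have hle : (numCells N : ℝ) ≤ A * (w ^ 2)⁻¹ := by
    rw [hKdef]; exact Nat.floor_le (by positivity)
  have hlt : A * (w ^ 2)⁻¹ < numCells N + 1 := by
    rw [hKdef]; exact Nat.lt_floor_add_one _
  have h1 : (1 : ℝ) ≤ numCells N := by exact_mod_cast (by omega : 1 ≤ numCells N)
  refine ⟨A, w, hA, hw1, hN, hlog, hA', hw4, ?_, ?_⟩
  · rwa [← div_eq_mul_inv, le_div_iff₀ (by positivity)] at hle
  · rw [← div_eq_mul_inv, div_lt_iff₀ (by positivity)] at hlt
    nlinarith [sq_nonneg w]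

end Parameters

/-! ### Numerical estimates for the chosen parameters -/

section Assembly

variable {N T : ℕ} {m : ℝ → ℝ} {L Q p : ℝ}

lemma regret_le_card {x : Fin N → ℝ} {φ : Fin T → Fin N} (hx : ∀ i, x i ∈ Set.Icc (0 : ℝ) 1)
    (hm : ∀ v ∈ Set.Icc (0 : ℝ) 1, m v ∈ Set.Icc (0 : ℝ) 1) : regret m x φ ≤ N := by
  have h1 : ∑ t ∈ (Finset.univ : Finset (Fin N)).filter (fun t : Fin N => (t : ℕ) < T),
      m (x (Tuple.sort (fun i => - m (x i)) t)) ≤ N := by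
    refine (Finset.sum_le_card_nsmul _ _ 1 fun t _ => (hm _ (hx _)).2).trans ?_
    rw [nsmul_eq_mul, mul_one]
    have := Finset.card_le_univ
      ((Finset.univ : Finset (Fin N)).filter (fun t : Fin N => (t : ℕ) < T))
    rw [Fintype.card_fin] at this
    exact_mod_cast this
  have h2 : 0 ≤ ∑ t : Fin T, m (x (φ t)) := Finset.sum_nonneg fun t _ => (hm _ (hx _)).1
  rw [regret]
  linarith

/-- The constant of the regret bound. -/
def regretConst (L Q : ℝ) : ℝ :=
  Real.exp (1000 * (Q + 1) ^ 2) + (2048 * (Q + 1) * (L + 1) ^ 2 + 600 * (Q + 1) + 2)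

/-- With `K` of order `A / w ^ 2`, both `A ^ 3 / K ^ 2` and `K * w ^ 6` are of order `A * w ^ 4`;
this balance dictates the number of cells. -/
lemma regret_bound_le {K A w ℓ : ℝ} (hL : 0 ≤ L) (hQ : 0 ≤ Q) (hK : 1 ≤ K) (hA : 0 < A)
    (hw : 1 ≤ w) (h1 : K * w ^ 2 ≤ A) (h2 : A ≤ 2 * K * w ^ 2) (hℓ : ℓ ≤ 7 / 3 * w ^ 3)
    (hlogK : Real.log K ≤ w ^ 3) :
    8 * (Q + 1) * (8 * (L + 1)) ^ 2 * (A ^ 3 / K ^ 2) + 128 * (Q + 1) * ℓ * K * (1 + Real.log K) +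
      2 * K ≤ (2048 * (Q + 1) * (L + 1) ^ 2 + 600 * (Q + 1) + 2) * A * w ^ 4 := by
  have hw4 : 1 ≤ w ^ 4 := one_le_pow₀ hw
  have hw3 : 1 ≤ w ^ 3 := one_le_pow₀ hw
  have hw2 : 1 ≤ w ^ 2 := one_le_pow₀ hw
  have e1 : A ^ 3 / K ^ 2 ≤ 4 * A * w ^ 4 := by
    rw [div_le_iff₀ (by positivity)]
    have : A ^ 2 ≤ (2 * K * w ^ 2) ^ 2 := by gcongr
    nlinarith [mul_le_mul_of_nonneg_left this hA.le]
  have hlog0 : 0 ≤ Real.log K := Real.log_nonneg hK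
  have e2 : ℓ * K * (1 + Real.log K) ≤ 14 / 3 * (A * w ^ 4) := by
    calc ℓ * K * (1 + Real.log K) ≤ (7 / 3 * w ^ 3) * K * (w ^ 3 + w ^ 3) := by gcongr
      _ = 14 / 3 * (K * w ^ 2) * w ^ 4 := by ring
      _ ≤ 14 / 3 * A * w ^ 4 := by gcongr
      _ = _ := by ring
  have e3 : K ≤ A * w ^ 4 := by
    have : K ≤ K * w ^ 2 := le_mul_of_one_le_right (by linarith) hw2
    have : A ≤ A * w ^ 4 := le_mul_of_one_le_right hA.le hw4
    linarith
  have hAw : 0 ≤ A * w ^ 4 := by positivity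
  calc _ = 512 * (Q + 1) * (L + 1) ^ 2 * (A ^ 3 / K ^ 2) +
        128 * (Q + 1) * (ℓ * K * (1 + Real.log K)) + 2 * K := by ring
    _ ≤ 512 * (Q + 1) * (L + 1) ^ 2 * (4 * A * w ^ 4) +
        128 * (Q + 1) * (14 / 3 * (A * w ^ 4)) + 2 * (A * w ^ 4) := by gcongr
    _ ≤ _ := by nlinarith [mul_nonneg (by linarith : 0 ≤ Q + 1) hAw]

/-- From `K ^ 3 * log n ^ 2 ≤ n`, every exponent is at least `2 * log n`, so each exponential is at
most `n⁻¹ * n⁻¹` and absorbs the factor `K`. The terms add up to `10 * n⁻¹`. -/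
lemma failure_bound_le {n K A w δ : ℝ} (hn : n = A ^ 3) (hlog : Real.log n = w ^ 3) (hA : 1 ≤ A)
    (hw : 1000 ≤ w ^ 3) (hw1 : 1 ≤ w) (hK : 3 ≤ K) (h1 : K * w ^ 2 ≤ A) (hδ : δ = (A ^ 4)⁻¹) :
    2 * K * Real.exp (-(n / (2 * K ^ 2))) + 4 * Real.exp (-(n / (8 * K ^ 2))) +
        2 * K * Real.exp (-(n / K ^ 3)) + 2 * K * δ ≤ 12 * n⁻¹ := by
  have hn0 : 0 < n := by rw [hn]; positivity
  have hn1 : 1 ≤ n := by rw [hn]; exact one_le_pow₀ hA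
  have hK0 : 0 < K := by linarith
  have hKA : K ≤ A := (le_mul_of_one_le_right hK0.le (one_le_pow₀ hw1)).trans h1
  have hKn : K ≤ n := by
    refine hKA.trans ?_
    rw [hn]
    exact le_self_pow₀ hA (by norm_num)
  have hcube : (w ^ 3) ^ 2 * K ^ 3 ≤ n := by
    rw [hn]
    calc (w ^ 3) ^ 2 * K ^ 3 = (K * w ^ 2) ^ 3 := by ring
      _ ≤ A ^ 3 := by gcongr
  have hexp : ∀ v, 2 * w ^ 3 ≤ v → Real.exp (-v) ≤ n⁻¹ * n⁻¹ := by
    intro v hv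
    rw [← hlog] at hv
    calc Real.exp (-v) ≤ Real.exp (-(Real.log n + Real.log n)) := by
          rw [Real.exp_le_exp]; linarith
      _ = n⁻¹ * n⁻¹ := by rw [Real.exp_neg, Real.exp_add, Real.exp_log hn0, mul_inv]
  have b3 := hexp (n / K ^ 3) (by
    rw [le_div_iff₀ (by positivity)]
    refine le_trans ?_ hcube
    gcongr
    nlinarith)
  have b2 := hexp (n / (8 * K ^ 2)) (by
    rw [le_div_iff₀ (by positivity)]
    refine le_trans ?_ hcube
    have : 16 ≤ w ^ 3 * K := by nlinarith
    have h5 : 0 ≤ w ^ 3 * K ^ 2 := by positivity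
    calc 2 * w ^ 3 * (8 * K ^ 2) = w ^ 3 * K ^ 2 * 16 := by ring
      _ ≤ w ^ 3 * K ^ 2 * (w ^ 3 * K) := by gcongr
      _ = _ := by ring)
  have b1 := hexp (n / (2 * K ^ 2)) (by
    rw [le_div_iff₀ (by positivity)]
    refine le_trans ?_ hcube
    have : 4 ≤ w ^ 3 * K := by nlinarith
    have h5 : 0 ≤ w ^ 3 * K ^ 2 := by positivity
    calc 2 * w ^ 3 * (2 * K ^ 2) = w ^ 3 * K ^ 2 * 4 := by ring
      _ ≤ w ^ 3 * K ^ 2 * (w ^ 3 * K) := by gcongr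
      _ = _ := by ring)
  have hinv : n⁻¹ ≤ 1 := inv_le_one_of_one_le₀ hn1
  have hinv0 : 0 < n⁻¹ := by positivity
  have hKinv : K * (n⁻¹ * n⁻¹) ≤ n⁻¹ := by
    calc K * (n⁻¹ * n⁻¹) ≤ n * (n⁻¹ * n⁻¹) := by gcongr
      _ = n⁻¹ := by field_simp
  have hinv2 : n⁻¹ * n⁻¹ ≤ n⁻¹ := mul_le_of_le_one_left hinv0.le hinv
  have hKδ : K * δ ≤ n⁻¹ := by
    rw [hδ, hn]
    calc K * (A ^ 4)⁻¹ ≤ A * (A ^ 4)⁻¹ := by gcongr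
      _ = (A ^ 3)⁻¹ := by field_simp
  have c1 : K * Real.exp (-(n / (2 * K ^ 2))) ≤ n⁻¹ :=
    (mul_le_mul_of_nonneg_left b1 hK0.le).trans hKinv
  have c3 : K * Real.exp (-(n / K ^ 3)) ≤ n⁻¹ :=
    (mul_le_mul_of_nonneg_left b3 hK0.le).trans hKinv
  linarith

/-- The right side is of order at least `K ^ 2 * w ^ 6`, the left of order `K ^ 2 * w ^ 3`; the
spare factor `w ^ 3` beats the constants. -/
lemma exhaustion_threshold_lt {n K w ℓ : ℝ} (hQ : 0 ≤ Q) (hK : 1 ≤ K)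
    (hw : 1000 * (Q + 1) ^ 2 ≤ w ^ 3) (hℓ : ℓ ≤ 7 / 3 * w ^ 3) (hn : (w ^ 3) ^ 2 * K ^ 3 ≤ n) :
    264 * (Q + 1) ^ 2 * ℓ * K ^ 2 + K < 3 * n / (4 * K) := by
  have hQ1 : 1 ≤ (Q + 1) ^ 2 := one_le_pow₀ (by linarith)
  have hw0 : 0 ≤ w ^ 3 := by linarith
  rw [lt_div_iff₀ (by positivity)]
  set X := (Q + 1) ^ 2 * (w ^ 3 * K ^ 3) with hX
  have h6 : 1000 * X ≤ (w ^ 3) ^ 2 * K ^ 3 := by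
    calc 1000 * X = 1000 * (Q + 1) ^ 2 * (w ^ 3 * K ^ 3) := by rw [hX]; ring
      _ ≤ w ^ 3 * (w ^ 3 * K ^ 3) := by gcongr
      _ = _ := by ring
  have h7 : w ^ 3 * K ^ 3 ≤ X := le_mul_of_one_le_left (by positivity) hQ1
  have h8 : K ^ 2 ≤ K ^ 3 := pow_le_pow_right₀ hK (by norm_num)
  have h9 : K ^ 3 ≤ w ^ 3 * K ^ 3 := le_mul_of_one_le_left (by positivity) (by linarith)
  have h10 : 0 < K ^ 3 := by positivity
  calc (264 * (Q + 1) ^ 2 * ℓ * K ^ 2 + K) * (4 * K)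
      ≤ (264 * (Q + 1) ^ 2 * (7 / 3 * w ^ 3) * K ^ 2 + K) * (4 * K) := by gcongr
    _ = 2464 * X + 4 * K ^ 2 := by rw [hX]; ring
    _ < 3 * n := by linarith

end Assembly

/-! ### The high-probability bound -/

section Main

variable {Ω : Type*} [MeasurableSpace Ω] {μ : Measure Ω} [IsProbabilityMeasure μ] {N T K : ℕ}
  {m : ℝ → ℝ} {L Q p : ℝ} {a y : Fin N → Ω → ℝ} {φ : Fin T → Ω → Fin N}
  {κ : Fin T → Ω → Fin K}

lemma one_sub_le_measureReal {S F : Set Ω} (h : ∀ᵐ ω ∂μ, ω ∉ F → ω ∈ S) :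
    1 - μ.real F ≤ μ.real S := by
  have h1 : (Set.univ : Set Ω) ≤ᵐ[μ] (S ∪ F : Set Ω) := by
    filter_upwards [h] with ω hω _
    by_cases hF : ω ∈ F
    · exact Or.inr hF
    · exact Or.inl (hω hF)
  have h2 : μ.real Set.univ ≤ μ.real (S ∪ F) :=
    ENNReal.toReal_mono (measure_ne_top _ _) (measure_mono_ae h1)
  have h3 := measureReal_union_le (μ := μ) S F
  rw [probReal_univ] at h2
  linarith

lemma regret_bound_with_high_probability (hKdef : K = numCells N) (hL : 0 < L) (hQ : 0 < Q) (hp : p ∈ Set.Ioo (0 : ℝ) 1)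
    (hTp : (T : ℝ) = p * N) (hK : max p⁻¹ (1 - p)⁻¹ < (K : ℝ)) (hmeas : Measurable m)
    (hm : ∀ x ∈ Set.Icc (0 : ℝ) 1, m x ∈ Set.Icc (0 : ℝ) 1)
    (hLip : WeaklyLipschitz m (threshold m p) L) (hmargin : MarginCondition m (threshold m p) Q)
    (hmodel : IsModel μ m a y) (hrun : IsUCBFRun μ ((N : ℝ) ^ (-(4 / 3) : ℝ)) a y φ κ) :
    1 - 12 * (N : ℝ)⁻¹ ≤
      μ.real {ω | regret m (fun i => a i ω) (fun t => φ t ω) ≤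
        regretConst L Q * (N : ℝ) ^ (1 / 3 : ℝ) * Real.log N ^ (4 / 3 : ℝ)} := by
  obtain ⟨hKp, hKq⟩ := max_lt_iff.1 hK
  have hp0 := hp.1
  have hq0 : 0 < 1 - p := by linarith [hp.2]
  have hpK : 1 ≤ p * K := by
    have := mul_lt_mul_of_pos_left hKp hp0
    rw [mul_inv_cancel₀ hp0.ne'] at this
    exact this.le
  have hqK : 1 ≤ (1 - p) * K := by
    have := mul_lt_mul_of_pos_left hKq hq0
    rw [mul_inv_cancel₀ hq0.ne'] at this
    exact this.le
  have hK2 : 2 < K := by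
    have : (2 : ℝ) < K := by
      rcases le_total p (1 / 2) with h | h
      · refine lt_of_le_of_lt ?_ hKp
        rw [le_inv_comm₀ (by norm_num) hp0]
        linarith
      · refine lt_of_le_of_lt ?_ hKq
        rw [le_inv_comm₀ (by norm_num) hq0]
        linarith
    exact_mod_cast this
  obtain ⟨A, w, hA, hw, hN, hlogN, hA', hw4, hKA, hAK⟩ := numCells_bounds (hKdef ▸ hK2)
  rw [← hKdef] at hKA hAK
  have hKpos : 0 < K := by omega
  have hK3 : (3 : ℝ) ≤ K := by exact_mod_cast hK2
  have hw2 : 1 ≤ w ^ 2 := one_le_pow₀ hw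
  have hKleA : (K : ℝ) ≤ A := (le_mul_of_one_le_right (by linarith) hw2).trans hKA
  have hA1 : 1 ≤ A := by linarith
  have hNpos : (0 : ℝ) < N := by rw [hN]; positivity
  have hNpos' : 0 < N := by exact_mod_cast hNpos
  have hAw : 1 ≤ A * w ^ 4 := by nlinarith [one_le_pow₀ hw (n := 4)]
  rw [hA', hw4]
  -- Otherwise `N` is bounded in terms of `Q`, and the exponential term of `regretConst` covers the
  -- trivial bound by `N`.
  by_cases hbig : 1000 * (Q + 1) ^ 2 ≤ w ^ 3
  · have hδ : (N : ℝ) ^ (-(4 / 3) : ℝ) = (A ^ 4)⁻¹ := by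
      rw [Real.rpow_neg hNpos.le, ← hA', ← Real.rpow_natCast, ← Real.rpow_mul hNpos.le]
      norm_num
    set δ := (N : ℝ) ^ (-(4 / 3) : ℝ) with hδdef
    have hδpos : 0 < δ := by positivity
    have hTpos : (0 : ℝ) < T := by rw [hTp]; positivity
    have hT1 : (1 : ℝ) ≤ T := by
      have : 0 < T := by exact_mod_cast hTpos
      exact_mod_cast this
    have hlogeq : Real.log (T / δ) = Real.log T + 4 / 3 * w ^ 3 := by
      rw [Real.log_div hTpos.ne' hδpos.ne', hδdef, Real.log_rpow hNpos, hlogN]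
      ring
    have hlog0 : 0 ≤ Real.log (T / δ) := by
      rw [hlogeq]
      have := Real.log_nonneg hT1
      positivity
    have hlogT : Real.log T ≤ w ^ 3 := by
      rw [← hlogN]
      refine Real.log_le_log hTpos ?_
      rw [hTp]
      nlinarith [hp.2]
    have hℓ : Real.log (T / δ) ≤ 7 / 3 * w ^ 3 := by rw [hlogeq]; linarith
    have hQ1 : 1 ≤ (Q + 1) ^ 2 := one_le_pow₀ (by linarith)
    have hw1000 : 1000 ≤ w ^ 3 := by linarith
    have hKcube : (w ^ 3) ^ 2 * (K : ℝ) ^ 3 ≤ N := by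
      rw [hN]
      calc (w ^ 3) ^ 2 * (K : ℝ) ^ 3 = (K * w ^ 2) ^ 3 := by ring
        _ ≤ A ^ 3 := by gcongr
    have h4K : 4 * (K : ℝ) ≤ N := by
      refine le_trans ?_ hKcube
      have h5 : (K : ℝ) ≤ (K : ℝ) ^ 3 := le_self_pow₀ (by linarith) (by norm_num)
      have h6 : (4 : ℝ) ≤ (w ^ 3) ^ 2 := by nlinarith
      exact mul_le_mul h6 h5 (by linarith) (by positivity)
    have hM := (threshold_mem hp hm).2.2
    set M := threshold m p with hMdef
    have habove : p * K + 1 ≤ (cellsAbove m M L K).card :=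
      card_cellsAbove_ge hLip hL.le hKpos hp0 (by linarith) (volume_threshold_le hp hmeas hm)
    have hbelow : (1 - p) * K + 1 ≤ (cellsAbove (fun v => - m v) (-M) L K).card :=
      card_cellsAbove_ge hLip.neg hL.le hKpos hq0 (by linarith) (le_volume_le_threshold hp hm)
    have hfail := measureReal_not_isGoodRun_le (M := M) (L := L) hmodel hrun hmeas hp hTp hKpos
      h4K hδpos hlog0 habove hbelow
    have hfail2 := failure_bound_le hN hlogN hA1 hw1000 hw hK3 hKA hδ
    have hthr : 264 * (Q + 1) ^ 2 * Real.log (T / δ) * (K : ℝ) ^ 2 + K < 3 * N / (4 * K) :=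
      exhaustion_threshold_lt hQ.le (by linarith) hbig hℓ hKcube
    have hlogK : Real.log K ≤ w ^ 3 := by
      rw [← hlogN]
      exact Real.log_le_log (by linarith) (by linarith)
    have hgood := one_sub_le_measureReal (μ := μ)
      (S := {ω | regret m (fun i => a i ω) (fun t => φ t ω) ≤ regretConst L Q * A * w ^ 4})
      (F := {ω | ¬ IsGoodRun m M L δ (fun i => a i ω) (fun i => y i ω) (fun t => φ t ω)
        (fun t => κ t ω)})
      (Filter.Eventually.of_forall fun ω hω => by
        have hω' := not_not.1 hω
        have h1 := hω'.regret_le hlog0 hNpos' hKpos hL.le (le_refl (8 * (L + 1))) hQ.le hLip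
          hmargin hM hm hthr
        rw [hN] at h1
        have h2 := regret_bound_le hL.le hQ.le (by linarith) hA hw hKA hAK hℓ hlogK
        have h3 : 0 ≤ Real.exp (1000 * (Q + 1) ^ 2) * A * w ^ 4 := by positivity
        change _ ≤ regretConst L Q * A * w ^ 4
        rw [regretConst, add_mul, add_mul]
        linarith)
    linarith
  · have hN' : (N : ℝ) ≤ Real.exp (1000 * (Q + 1) ^ 2) := by
      rw [← Real.log_le_iff_le_exp hNpos, hlogN]
      exact (not_le.1 hbig).le
    have hgood := one_sub_le_measureReal (μ := μ)
      (S := {ω | regret m (fun i => a i ω) (fun t => φ t ω) ≤ regretConst L Q * A * w ^ 4})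
      (F := ∅) (by
        filter_upwards [hmodel.ae_covariate_mem] with ω hω _
        have h1 := regret_le_card (φ := fun t => φ t ω) hω hm
        have h2 : Real.exp (1000 * (Q + 1) ^ 2) ≤ regretConst L Q := by
          rw [regretConst]
          have : 0 ≤ 2048 * (Q + 1) * (L + 1) ^ 2 + 600 * (Q + 1) + 2 := by positivity
          linarith
        have h3 : regretConst L Q ≤ regretConst L Q * (A * w ^ 4) :=
          le_mul_of_one_le_right ((Real.exp_pos _).le.trans h2) hAw
        change _ ≤ regretConst L Q * A * w ^ 4
        rw [mul_assoc]
        linarith)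
    rw [measureReal_empty, sub_zero] at hgood
    refine le_trans ?_ hgood
    have : (0 : ℝ) ≤ (N : ℝ)⁻¹ := by positivity
    linarith

end Main

end FCAB

end

theorem theorem1 (L Q : ℝ) (hL : 0 < L) (hQ : 0 < Q) :
    ∃ C : ℝ, 0 < C ∧
      ∀ (N T : ℕ) (p : ℝ), p ∈ Set.Ioo (0 : ℝ) 1 → (T : ℝ) = p * N →
      max p⁻¹ (1 - p)⁻¹ < (FCAB.numCells N : ℝ) →
      ∀ m : ℝ → ℝ, Measurable m → (∀ x ∈ Set.Icc (0 : ℝ) 1, m x ∈ Set.Icc (0 : ℝ) 1) →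
      FCAB.WeaklyLipschitz m (FCAB.threshold m p) L →
      FCAB.MarginCondition m (FCAB.threshold m p) Q →
      ∀ (Ω : Type*) [MeasurableSpace Ω] (μ : MeasureTheory.Measure Ω)
        [MeasureTheory.IsProbabilityMeasure μ]
        (a y : Fin N → Ω → ℝ) (φ : Fin T → Ω → Fin N) (κ : Fin T → Ω → Fin (FCAB.numCells N)),
      FCAB.IsModel μ m a y →
      FCAB.IsUCBFRun μ ((N : ℝ) ^ (-(4 / 3) : ℝ)) a y φ κ →
      1 - 12 * max ((N : ℝ)⁻¹) (Real.exp (-((N : ℝ) ^ (1 / 3 : ℝ)) / 3)) ≤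
        μ.real {ω | FCAB.regret m (fun i => a i ω) (fun t => φ t ω) ≤
          C * ((T : ℝ) / p) ^ (1 / 3 : ℝ) * Real.log ((T : ℝ) / p) ^ (4 / 3 : ℝ)} := by
  refine ⟨FCAB.regretConst L Q, ?_, ?_⟩
  · unfold FCAB.regretConst
    positivity
  intro N T p hp hTp hK m hmeas hm hLip hmargin Ω _ μ _ a y φ κ hmodel hrun
  have hN : (T : ℝ) / p = N := by
    rw [hTp, mul_div_cancel_left₀ _ hp.1.ne']
  rw [hN]
  refine le_trans ?_ (FCAB.regret_bound_with_high_probability rfl hL hQ hp hTp hK hmeas hm hLip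
    hmargin hmodel hrun)
  -- The failure probability is already at most `12 * N⁻¹`, so the other branch of the maximum plays
  -- no role.
  gcongr
  exact le_max_left _ _
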